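/- Let $q$ be an indeterminate and let $\mathcal R_n$ ($n\ge 0$) be the generic mirabolic Hecke algebra over $\mathbb C(q)$, i.e. the $\mathbb C(q)$-algebra with generators $T_0,T_1,\dots,T_{n-1}$ and relations $$T_0^2=(q-2)T_0+(q-1),\qquad T_i^2=(q-1)T_i+q\ (i\ge1),\qquad T_iT_{i+1}T_i=T_{i+1}T_iT_{i+1}\ (i\ge1),$$ $$T_0T_1T_0T_1=(q-1)(T_1T_0T_1+T_1T_0)-T_0T_1T_0,\qquad T_1T_0T_1T_0=(q-1)(T_1T_0T_1+T_0T_1)-T_0T_1T_0,$$ $$T_iT_j=T_jT_i\ (|i-j|\ge2).$$ For $n\ge1$ put $e=q^{-1}(T_0+1)$ and let $L_n=q^{1-n}\,T_{n-1}\cdots T_1\,e\,T_1\cdots T_{n-1}\in\mathcal R_n$ be the last Jucys--Murphy element. The box in row $l$ and column $m$ of a Young diagram has content $m-l$. Let $1^k$ be the partition whose diagram is a single column of $k$ boxes. For a partition $\lambda^1$ and $k\ge0$ with $|\lambda^1|+k=n$, let $M^{(\lambda^1,1^k)}$ be the $\mathbb C(q)$-vector space with basis $v_U$, where $U=(U^1,U^2)$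 runs over the standard bitableaux of shape $(\lambda^1,1^k)$ (the boxes of the two diagrams are filled with $1,\dots,n$, each used once, increasing along rows and down columns of each diagram). The generators $e$ (if $n\ge1$) and $T_1,\dots,T_{n-1}$ act by: $e\,v_U=v_U$ if $1\in U^1$ and $e\,v_U=0$ if $1\in U^2$; $$T_iv_U=\begin{cases} q\,v_U & i,i+1 \text{ in the same row of the same tableau},\\ -v_U & i,i+1\text{ in the same column of the same tableau},\\ \frac{q-1}{1-q^{d}}v_U+\Bigl(1+\frac{q-1}{1-q^{d}}\Bigr)v_{s_i(U)} & i,i+1\text{ in the same tableau, not in the same row or column},\\ v_{s_i(U)} & i\in U^1,\ i+1\in U^2,\\ (q-1)v_U+q\,v_{s_i(U)} & i\in U^2,\ i+1\in U^1,\end{cases}$$ where $s_i(U)$ is $U$ with $i$ and $i+1$ exchanged and $d$ is the content of the box of $i$ minus the content of the box of $i+1$. These formulas define a unique $\mathcal R_n$-module structure on $M^{(\lambda^1,1^k)}$, and this module is irreducible. For $n\ge1$, an $\mathcal R_n$-module $M$ and $\alpha\in\mathbb C(q)$, let $M(\alpha)$ be the generalized $\alpha$-eigenspace of $L_n$ on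 $M$, with $\mathcal R_{n-1}$ acting through the homomorphism $\mathcal R_{n-1}\to\mathcal R_n$, $T_i\mapsto T_i$. **Proposition.** Let $n\ge1$ and $|\lambda^1|+k=n$. Every generalized eigenspace of $L_n$ on $M^{(\lambda^1,1^k)}$ is an eigenspace, and: (i) For every $i\in\mathbb Z$ there is at most one partition $\lambda^1[i^-]$ obtained from $\lambda^1$ by removing a box of content $i$. If it exists, then $M^{(\lambda^1,1^k)}(q^i)$ is stable under $\mathcal R_{n-1}$ and $M^{(\lambda^1,1^k)}(q^i)\cong M^{(\lambda^1[i^-],1^k)}$ as $\mathcal R_{n-1}$-modules; if it does not exist, then $M^{(\lambda^1,1^k)}(q^i)=0$. (ii) If $k\ge1$, then $M^{(\lambda^1,1^k)}(0)$ is stable under $\mathcal R_{n-1}$ and $M^{(\lambda^1,1^k)}(0)\cong M^{(\lambda^1,1^{k-1})}$ as $\mathcal R_{n-1}$-modules; if $k=0$, then $M^{(\lambda^1,1^k)}(0)=0$. -/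

import Mathlib

noncomputable section

namespace Mirabolic

/-! ### The generic mirabolic Hecke algebra -/

/-- The base field `ℂ(q)`. -/
abbrev K : Type := RatFunc ℂ

/-- The indeterminate `q` of `ℂ(q)`. -/
def q : K := RatFunc.X

/-- The free generators `T_0, …, T_{n-1}`. -/
abbrev t {n : ℕ} (i : Fin n) : FreeAlgebra K (Fin n) := FreeAlgebra.ι K i

/-- Solomon's relations between `T_0, T_1, …, T_{n-1}`. -/
inductive Rel (n : ℕ) : FreeAlgebra K (Fin n) → FreeAlgebra K (Fin n) → Prop
  /-- `T_0² = (q-2) T_0 + (q-1)` -/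
  | zero_sq (o : Fin n) (ho : o.val = 0) :
      Rel n (t o * t o) ((q - 2) • t o + (q - 1) • 1)
  /-- `T_i² = (q-1) T_i + q` for `i ≥ 1` -/
  | quad (i : Fin n) (hi : 1 ≤ i.val) :
      Rel n (t i * t i) ((q - 1) • t i + q • 1)
  /-- `T_i T_{i+1} T_i = T_{i+1} T_i T_{i+1}` for `i ≥ 1` -/
  | braid (i j : Fin n) (hi : 1 ≤ i.val) (hj : j.val = i.val + 1) :
      Rel n (t i * t j * t i) (t j * t i * t j)
  /-- `T_0T_1T_0T_1 = (q-1)(T_1T_0T_1 + T_1T_0) - T_0T_1T_0` -/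
  | mixed (o i : Fin n) (ho : o.val = 0) (hi : i.val = 1) :
      Rel n (t o * t i * t o * t i)
        ((q - 1) • (t i * t o * t i + t i * t o) - t o * t i * t o)
  /-- `T_1T_0T_1T_0 = (q-1)(T_1T_0T_1 + T_0T_1) - T_0T_1T_0` -/
  | mixed' (o i : Fin n) (ho : o.val = 0) (hi : i.val = 1) :
      Rel n (t i * t o * t i * t o)
        ((q - 1) • (t i * t o * t i + t o * t i) - t o * t i * t o)
  /-- `T_i T_j = T_j T_i` for `|i-j| ≥ 2` -/
  | comm (i j : Fin n) (h : i.val + 2 ≤ j.val) :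
      Rel n (t i * t j) (t j * t i)

/-- The generic mirabolic Hecke algebra over `ℂ(q)`. -/
abbrev R (n : ℕ) : Type := RingQuot (Rel n)

/-- The generator `T_i` of `R n`, for `0 ≤ i ≤ n-1`. -/
def T {n : ℕ} (i : Fin n) : R n := RingQuot.mkAlgHom K (Rel n) (t i)

/-- The idempotent `e = q⁻¹ (T_0 + 1)`. -/
def e {n : ℕ} (h : 0 < n) : R n := q⁻¹ • (T ⟨0, h⟩ + 1)

/-- `JM i h` is the Jucys–Murphy element
`L_{i+1} = q^{-i} T_i ⋯ T_1 e T_1 ⋯ T_i`, built up through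
`L_1 = e` and `L_{i+1} = q⁻¹ T_i L_i T_i`. -/
def JM {n : ℕ} : (i : ℕ) → i < n → R n
  | 0, h => e h
  | i + 1, h => q⁻¹ • (T ⟨i + 1, h⟩ * JM i (Nat.lt_of_succ_lt h) * T ⟨i + 1, h⟩)

/-- The last Jucys–Murphy element `L_{n+1}` of `R (n+1)`. -/
def lastJM (n : ℕ) : R (n + 1) := JM n (Nat.lt_succ_self n)

/-- The homomorphism `R n → R (n+1)` that sends each generator `T_i` to `T_i`. -/
def incl (n : ℕ) : R n →ₐ[K] R (n + 1) :=
  RingQuot.liftAlgHom K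
    ⟨FreeAlgebra.lift K (fun i : Fin n => (T i.castSucc : R (n + 1))), by
      intro x y hxy
      cases hxy with
      | zero_sq o ho =>
        simpa [T] using RingQuot.mkAlgHom_rel K (Rel.zero_sq o.castSucc (by simpa using ho))
      | quad i hi =>
        simpa [T] using RingQuot.mkAlgHom_rel K (Rel.quad i.castSucc (by simpa using hi))
      | braid i j hi hj =>
        simpa [T] using RingQuot.mkAlgHom_rel K
          (Rel.braid i.castSucc j.castSucc (by simpa using hi) (by simpa using hj))
      | mixed o i ho hi =>
        simpa [T] using RingQuot.mkAlgHom_rel K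
          (Rel.mixed o.castSucc i.castSucc (by simpa using ho) (by simpa using hi))
      | mixed' o i ho hi =>
        simpa [T] using RingQuot.mkAlgHom_rel K
          (Rel.mixed' o.castSucc i.castSucc (by simpa using ho) (by simpa using hi))
      | comm i j h =>
        simpa [T] using RingQuot.mkAlgHom_rel K
          (Rel.comm i.castSucc j.castSucc (by simpa using h))⟩

/-! ### Standard bitableaux -/

/-- A pair of Young diagrams `(λ¹, λ²)`; `L 0` is `λ¹` and `L 1` is `λ²`. -/
abbrev Bipartition : Type := Fin 2 → YoungDiagram

/-- The boxes `(j, row, column)` of a bipartition. -/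
abbrev Box (L : Bipartition) : Type := {b : Fin 2 × ℕ × ℕ // b.2 ∈ L b.1}

namespace Box

variable {L : Bipartition}

/-- The component (`0` for `λ¹`, `1` for `λ²`) in which a box lies. -/
def comp (b : Box L) : Fin 2 := b.1.1

/-- The row of a box. -/
def row (b : Box L) : ℕ := b.1.2.1

/-- The column of a box. -/
def col (b : Box L) : ℕ := b.1.2.2

/-- The content of a box: column minus row, raised by one in the second component. -/
def content (b : Box L) : ℤ := (b.comp.val : ℤ) + ((b.col : ℤ) - (b.row : ℤ))

end Box

/-- A filling of the boxes of `L` by `1, …, n`, each used once. The element `i : Fin n` stands for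
the entry `i + 1`, and `U i` is the box that contains it. -/
abbrev Filling (n : ℕ) (L : Bipartition) : Type := Fin n ≃ Box L

/-- The entries increase along the rows and down the columns of each of the two tableaux. -/
def IsStandard {n : ℕ} {L : Bipartition} (U : Filling n L) : Prop :=
  ∀ i j : Fin n, (U i).comp = (U j).comp →
    ((U i).row = (U j).row → (U i).col < (U j).col → i < j) ∧
    ((U i).col = (U j).col → (U i).row < (U j).row → i < j)

/-- Standard bitableaux of shape `L` with entries `1, …, n`. -/
def StdBitableau (n : ℕ) (L : Bipartition) : Type := {U : Filling n L // IsStandard U}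

/-- The `ℂ(q)`-vector space with basis the standard bitableaux of shape `L`. -/
abbrev M (n : ℕ) (L : Bipartition) : Type := StdBitableau n L →₀ K

/-- The basis vector `v_U` if `U` is standard, and `0` otherwise. -/
def vec {n : ℕ} {L : Bipartition} (U : Filling n L) : M n L :=
  open Classical in
  if h : IsStandard U then Finsupp.single ⟨U, h⟩ 1 else 0

/-! ### The seminormal operators -/

/-- The operator by which `e` acts: `v_U ↦ v_U` if `1` is in `U¹`, and `v_U ↦ 0` otherwise. -/
def opE {n : ℕ} (L : Bipartition) (h : 0 < n) : Module.End K (M n L) :=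
  Finsupp.linearCombination K fun U : StdBitableau n L =>
    if (U.1 ⟨0, h⟩).comp = 0 then vec U.1 else 0

/-- The image of `v_U` under the seminormal operator for the exchange of two entries `x`, `y`
(used with `y = x + 1`). -/
def seminormal {n : ℕ} {L : Bipartition} (x y : Fin n) (U : Filling n L) : M n L :=
  let b := U x
  let c := U y
  let sU : Filling n L := (Equiv.swap x y).trans U
  if b.comp = c.comp then
    if b.row = c.row then q • vec U
    else if b.col = c.col then - vec U
    else
      let a : K := (q - 1) / (1 - q ^ (b.content - c.content))
      a • vec U + (1 + a) • vec sU
  else if b.comp = 0 then vec sU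
  else (q - 1) • vec U + q • vec sU

/-- The operator by which `T_i` acts, `i ≥ 1`. It exchanges the entries `i` and `i+1`, which are
the elements `i - 1` and `i` of `Fin n`. -/
def opT {n : ℕ} (L : Bipartition) (i : Fin n) : Module.End K (M n L) :=
  Finsupp.linearCombination K fun U : StdBitableau n L =>
    seminormal ⟨i.val - 1, lt_of_le_of_lt (Nat.sub_le _ _) i.isLt⟩ i U.1

/-- `ρ` is the `R n`-module structure on `M n L` given by the seminormal formulas for the
generators `e, T_1, …, T_{n-1}`. -/
def IsSeminormal {n : ℕ} {L : Bipartition} (ρ : R n →ₐ[K] Module.End K (M n L)) : Prop :=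
  (∀ h : 0 < n, ρ (e h) = opE L h) ∧ ∀ i : Fin n, 1 ≤ i.val → ρ (T i) = opT L i

/-! ### Shapes -/

/-- The partition `1^k`, a single column with `k` boxes. -/
def column (k : ℕ) : YoungDiagram where
  cells := Finset.range k ×ˢ {0}
  isLowerSet := by
    rintro ⟨a, b⟩ ⟨c, d⟩ ⟨h1, h2⟩ h
    simp only [Finset.coe_product, Set.mem_prod, Finset.mem_coe, Finset.mem_range,
      Finset.mem_singleton] at h ⊢
    simp only at h1 h2
    omega

/-- The bipartition `(λ, 1^k)`. -/
def shape (lam : YoungDiagram) (k : ℕ) : Bipartition := ![lam, column k]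

/-- `mu` is obtained from `lam` by removing a box of content `i`. -/
def RemovesBox (lam mu : YoungDiagram) (i : ℤ) : Prop :=
  ∃ r c : ℕ, (r, c) ∈ lam ∧ (c : ℤ) - (r : ℤ) = i ∧ mu.cells = lam.cells.erase (r, c)

/-! ### Representations of `R n` -/

section Reps

variable {V V' : Type} [AddCommGroup V] [Module K V] [AddCommGroup V'] [Module K V']

/-- The `R n`-module given by `ρ` is irreducible. -/
def IsIrreducible {n : ℕ} (ρ : R n →ₐ[K] Module.End K V) : Prop :=
  Nontrivial V ∧
    ∀ W : Submodule K V, (∀ r : R n, ∀ w ∈ W, ρ r w ∈ W) → W = ⊥ ∨ W = ⊤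

/-- The generalized eigenspace of the last Jucys–Murphy element for `α`. -/
def jmSpace {n : ℕ} (ρ : R (n + 1) →ₐ[K] Module.End K V) (α : K) : Submodule K V :=
  (ρ (lastJM n)).maxGenEigenspace α

/-- The generalized eigenspace of the last Jucys–Murphy element for `α` is stable under the image
of `R n` in `R (n+1)` and, as an `R n`-module, is isomorphic to the module given by `ρ'`. -/
def JMSpaceIso {n : ℕ} (ρ : R (n + 1) →ₐ[K] Module.End K V) (α : K)
    (ρ' : R n →ₐ[K] Module.End K V') : Prop :=
  ∃ φ : V' ≃ₗ[K] jmSpace ρ α,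
    ∀ (r : R n) (w : V'), (φ (ρ' r w) : V) = ρ (incl n r) (φ w : V)

end Reps

end Mirabolic

end

noncomputable section

namespace Mirabolic

/-! ### Coefficients of the seminormal form -/

/-! With `vec U = 0` for nonstandard `U`, each T_i with i ≥ 1 acts by a single formula T_i v_U = a
v_U + g v_{s_i U} (`opT_vec`). Here a depends only on the boxes b, c of i and i+1. It is
(q-1)z/(z-x) inside one component, where x, z are q to the contents of b, c, and it is 0 or q-1
across components. The Hecke relations thus become scalar identities: a + a' = q-1
(`diagCoeff_add`), g g' = a a' + q (`IsStandard.swapCoeff_mul`) and an identity of Yang–Baxter type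
(`diagCoeff_triple`). The mixed relations are checked on the components of the entries 1 and 2, and
only two entries in U² require the column shape.

Give a box of λ¹ the weight q^content and a box of 1^k the weight 0. By `diagCoeff_mul_weight` and
the recursion L_{i+1} = q⁻¹ T_i L_i T_i, every v_U is an eigenvector of every L_i, with eigenvalue
the weight of the box of i (`IsSeminormal.JM_vec`). Boxes of equal weight are comparable, so the
weights separate standard bitableaux (`eq_of_weight_eq`). Hence a nonzero submodule contains some
v_U, and nonvanishing g together with `IsStandard.connected` gives all the others.

The eigenspaces of L_n are spanned by the v_U whose entry n lies in a box of given weight. Such a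
box is removable, and at most one removable box has that weight. Placing n there commutes with the
smaller algebra, as the coefficients see only the boxes (`IsRemoval.extendMap_apply`). -/

theorem q_ne_zero : q ≠ 0 := RatFunc.X_ne_zero

theorem q_pow_ne_one {m : ℕ} (hm : m ≠ 0) : q ^ m ≠ 1 := by
  intro h
  have h' : algebraMap (Polynomial ℂ) K (Polynomial.X ^ m) = algebraMap (Polynomial ℂ) K 1 := by
    simpa [q] using h
  have h2 := congrArg Polynomial.natDegree (RatFunc.algebraMap_injective ℂ h')
  simp at h2
  exact hm h2

theorem q_zpow_ne_one {d : ℤ} (hd : d ≠ 0) : q ^ d ≠ 1 := by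
  obtain ⟨m, rfl | rfl⟩ := d.eq_nat_or_neg
  · rw [zpow_natCast]
    exact q_pow_ne_one (by simpa using hd)
  · rw [zpow_neg, zpow_natCast, Ne, inv_eq_one]
    exact q_pow_ne_one (by simpa using hd)

theorem q_zpow_inj {d d' : ℤ} (h : q ^ d = q ^ d') : d = d' := by
  by_contra hne
  apply q_zpow_ne_one (sub_ne_zero.mpr hne)
  rw [zpow_sub₀ q_ne_zero, h, div_self (zpow_ne_zero _ q_ne_zero)]

theorem q_ne_one : q ≠ 1 := by simpa using q_pow_ne_one one_ne_zero

variable {n : ℕ} {L : Bipartition}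

/-- The coefficient of `v_U` in the seminormal form, for entries in the boxes `b` and `c`. -/
def diagCoeff (b c : Box L) : K :=
  if b.comp = c.comp then (q - 1) / (1 - q ^ (b.content - c.content))
  else if b.comp = 0 then 0 else q - 1

/-- The coefficient of the exchanged basis vector in the seminormal form. -/
def swapCoeff (b c : Box L) : K :=
  if b.comp = c.comp ∧ (b.row = c.row ∨ b.col = c.col) then 0 else 1 + diagCoeff b c

/-- The eigenvalue of a Jucys–Murphy element attached to a box. -/
def weight (b : Box L) : K := if b.comp = 0 then q ^ b.content else 0

/-- Two boxes do not lie on a common diagonal of the same component. -/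
def OffDiagonal (b c : Box L) : Prop := b.comp = c.comp → b.content ≠ c.content

theorem OffDiagonal.symm {b c : Box L} (h : OffDiagonal b c) : OffDiagonal c b :=
  fun h' h'' => h h'.symm h''.symm

theorem one_sub_q_zpow_ne {d d' : ℤ} (h : d ≠ d') : (q ^ d' - q ^ d : K) ≠ 0 :=
  sub_ne_zero.mpr fun h' => h (q_zpow_inj h').symm

theorem diagCoeff_same {b c : Box L} (h : b.comp = c.comp) :
    diagCoeff b c = (q - 1) * q ^ c.content / (q ^ c.content - q ^ b.content) := by
  have hc : (q ^ c.content : K) ≠ 0 := zpow_ne_zero _ q_ne_zero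
  rw [diagCoeff, if_pos h, zpow_sub₀ q_ne_zero, one_sub_div hc, div_div_eq_mul_div]

theorem fin_two_cases (j : Fin 2) : j = 0 ∨ j = 1 := by omega

theorem diagCoeff_add {b c : Box L} (h : OffDiagonal b c) :
    diagCoeff b c + diagCoeff c b = q - 1 := by
  by_cases hbc : b.comp = c.comp
  · rw [diagCoeff_same hbc, diagCoeff_same hbc.symm]
    have h1 := one_sub_q_zpow_ne (h hbc)
    have h2 := one_sub_q_zpow_ne (h hbc).symm
    field_simp
    ring
  · rcases fin_two_cases b.comp with hb | hb <;> rcases fin_two_cases c.comp with hc | hc <;>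
      simp_all [diagCoeff]

/-- This is what kills the v_{s_i U} term in T_i L_i T_i v_U. Inside λ¹ the two products are
(q-1)xz/(z-x) and its negative. -/
theorem diagCoeff_mul_weight {b c : Box L} (h : OffDiagonal b c) :
    diagCoeff b c * weight b + diagCoeff c b * weight c = 0 := by
  by_cases hbc : b.comp = c.comp
  · rcases fin_two_cases b.comp with hb | hb
    · rw [diagCoeff_same hbc, diagCoeff_same hbc.symm, weight, weight, if_pos hb,
        if_pos (hbc ▸ hb)]
      have h1 := one_sub_q_zpow_ne (h hbc)
      have h2 := one_sub_q_zpow_ne (h hbc).symm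
      field_simp
      ring
    · simp [weight, ← hbc, hb]
  · rcases fin_two_cases b.comp with hb | hb <;> rcases fin_two_cases c.comp with hc | hc <;>
      simp_all [diagCoeff, weight]

/-- The factor z - x cancels, since y/(y-x) + z/(z-y) - 1 = y(z-x)/((y-x)(z-y)). -/
theorem triple_identity {F : Type*} [Field F] (p : F) {x y z : F} (hyx : y - x ≠ 0)
    (hzy : z - y ≠ 0) (hzx : z - x ≠ 0) :
    p * z / (z - x) * (p * y / (y - x) + p * z / (z - y) - p) =
      p * y / (y - x) * (p * z / (z - y)) := by
  rw [div_add_div _ _ hyx hzy, div_sub' (mul_ne_zero hyx hzy), div_mul_div_comm, div_mul_div_comm,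
    div_eq_div_iff (mul_ne_zero hzx (mul_ne_zero hyx hzy)) (mul_ne_zero hyx hzy)]
  ring

theorem diagCoeff_triple {b c d : Box L} (h₁ : OffDiagonal b c) (h₂ : OffDiagonal c d)
    (h₃ : OffDiagonal b d) :
    diagCoeff b d * (diagCoeff b c + diagCoeff c d - (q - 1)) = diagCoeff b c * diagCoeff c d := by
  have key : ∀ {x y : Box L}, x.comp ≠ y.comp →
      diagCoeff x y = if x.comp = 0 then 0 else q - 1 := fun h => by rw [diagCoeff, if_neg h]
  have key' : ∀ {x y z : Box L}, x.comp = y.comp → x.comp ≠ z.comp →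
      diagCoeff x z = diagCoeff y z ∧ diagCoeff z x = diagCoeff z y := fun h h' => by
    rw [key h', key (h ▸ h'), key h'.symm, key (h ▸ h'.symm), h]
    exact ⟨rfl, rfl⟩
  by_cases hbc : b.comp = c.comp <;> by_cases hcd : c.comp = d.comp
  · rw [diagCoeff_same hbc, diagCoeff_same hcd, diagCoeff_same (hbc.trans hcd)]
    have h1 := one_sub_q_zpow_ne (h₁ hbc)
    have h2 := one_sub_q_zpow_ne (h₂ hcd)
    have h3 := one_sub_q_zpow_ne (h₃ (hbc.trans hcd))
    exact triple_identity (q - 1) h1 h2 h3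
  -- The coefficients at (b, d) and (c, d) agree and equal 0 or q-1, the roots of t(t - (q-1)).
  · rw [(key' hbc (hbc ▸ hcd)).1, key hcd]
    split_ifs <;> ring
  · rw [← (key' hcd (Ne.symm hbc)).2, key hbc]
    split_ifs <;> ring
  -- Here b and d lie opposite to c, so one of the two coefficients is 0 and the other q-1: the
  -- bracket and the product both vanish.
  · rw [key hbc, key hcd]
    rcases fin_two_cases b.comp with hb | hb <;> rcases fin_two_cases c.comp with hc | hc
    · exact absurd (hb.trans hc.symm) hbc
    · simp [hb, hc]
    · simp [hb, hc]
    · exact absurd (hb.trans hc.symm) hbc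

/-! ### Consecutive entries of standard bitableaux -/

theorem Box.ext {b c : Box L} (h : b.comp = c.comp) (hr : b.row = c.row) (hc : b.col = c.col) :
    b = c := by
  obtain ⟨⟨_, _, _⟩, _⟩ := b
  obtain ⟨⟨_, _, _⟩, _⟩ := c
  simp only [Box.comp, Box.row, Box.col] at h hr hc
  subst h hr hc
  rfl

theorem Box.exists_of_le (c : Box L) {r s : ℕ} (hr : r ≤ c.row) (hs : s ≤ c.col) :
    ∃ b : Box L, b.comp = c.comp ∧ b.row = r ∧ b.col = s :=
  ⟨⟨(c.comp, r, s), (L c.comp).up_left_mem hr hs c.2⟩, rfl, rfl, rfl⟩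

/-- Go through the box in the row of i and the column of j: entries grow along the row, then down
the column. -/
theorem IsStandard.le {U : Filling n L} (hU : IsStandard U) {i j : Fin n}
    (h : (U i).comp = (U j).comp) (hr : (U i).row ≤ (U j).row) (hc : (U i).col ≤ (U j).col) :
    i ≤ j := by
  obtain ⟨b, hb, hbr, hbc⟩ := (U j).exists_of_le hr le_rfl
  obtain ⟨m, rfl⟩ := U.surjective b
  have him : i ≤ m := by
    rcases hc.eq_or_lt with hc | hc
    · exact (U.injective (Box.ext (h.trans hb.symm) hbr.symm (hc.trans hbc.symm))).le
    · exact ((hU i m (h.trans hb.symm)).1 hbr.symm (hbc ▸ hc)).le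
  have hmj : m ≤ j := by
    rcases hr.eq_or_lt with hr | hr
    · exact (U.injective (Box.ext hb (hbr.trans hr) hbc)).le
    · exact ((hU m j hb).2 hbc (hbr ▸ hr)).le
  exact him.trans hmj

theorem IsStandard.lt {U : Filling n L} (hU : IsStandard U) {i j : Fin n}
    (h : (U i).comp = (U j).comp) (hr : (U i).row ≤ (U j).row) (hc : (U i).col ≤ (U j).col)
    (hne : (U i).row ≠ (U j).row ∨ (U i).col ≠ (U j).col) : i < j := by
  refine lt_of_le_of_ne (hU.le h hr hc) ?_
  rintro rfl
  simp at hne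

theorem Box.content_eq_iff {b c : Box L} (h : b.comp = c.comp) :
    b.content = c.content ↔ b.col + c.row = c.col + b.row := by
  simp only [Box.content, h]
  omega

/-- The right and lower neighbours of the box of i hold two distinct entries strictly between i and
j. So no denominator vanishes for entries at distance at most 2, which is all the braid relation
needs. -/
theorem IsStandard.three_le_of_content_eq {U : Filling n L} (hU : IsStandard U) {i j : Fin n}
    (hij : i < j) (h : (U i).comp = (U j).comp) (hc : (U i).content = (U j).content) :
    i.val + 3 ≤ j.val := by
  rw [Box.content_eq_iff h] at hc
  have hlt : (U i).row < (U j).row := by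
    by_contra hle
    exact absurd (hU.le h.symm (by omega) (by omega)) (not_le.mpr hij)
  obtain ⟨b, hb, hbr, hbc⟩ := (U j).exists_of_le (r := (U i).row) (s := (U i).col + 1)
    (by omega) (by omega)
  obtain ⟨c, hc', hcr, hcc⟩ := (U j).exists_of_le (r := (U i).row + 1) (s := (U i).col)
    (by omega) (by omega)
  obtain ⟨k, rfl⟩ := U.surjective b
  obtain ⟨l, rfl⟩ := U.surjective c
  have h1 : i < k := hU.lt (h.trans hb.symm) (by omega) (by omega) (by omega)
  have h2 : k < j := hU.lt hb (by omega) (by omega) (by omega)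
  have h3 : i < l := hU.lt (h.trans hc'.symm) (by omega) (by omega) (by omega)
  have h4 : l < j := hU.lt hc' (by omega) (by omega) (by omega)
  have h5 : k ≠ l := by
    rintro rfl
    omega
  omega

theorem IsStandard.offDiagonal {U : Filling n L} (hU : IsStandard U) {i j : Fin n}
    (hij : i < j) (hj : j.val ≤ i.val + 2) : OffDiagonal (U i) (U j) := fun h hc => by
  have := hU.three_le_of_content_eq hij h hc
  omega

theorem IsStandard.col_succ {U : Filling n L} (hU : IsStandard U) {x y : Fin n}
    (hxy : x.val + 1 = y.val) (h : (U x).comp = (U y).comp) (hr : (U x).row = (U y).row) :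
    (U y).col = (U x).col + 1 := by
  have hlt : (U x).col < (U y).col := by
    by_contra hle
    have := hU.le h.symm hr.ge (by omega)
    omega
  by_contra hne
  obtain ⟨b, hb, hbr, hbc⟩ := (U y).exists_of_le (r := (U x).row) (s := (U x).col + 1)
    (by omega) (by omega)
  obtain ⟨k, rfl⟩ := U.surjective b
  have h1 : x < k := hU.lt (h.trans hb.symm) (by omega) (by omega) (by omega)
  have h2 : k < y := hU.lt hb (by omega) (by omega) (by omega)
  omega

theorem IsStandard.row_succ {U : Filling n L} (hU : IsStandard U) {x y : Fin n}
    (hxy : x.val + 1 = y.val) (h : (U x).comp = (U y).comp) (hc : (U x).col = (U y).col) :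
    (U y).row = (U x).row + 1 := by
  have hlt : (U x).row < (U y).row := by
    by_contra hle
    have := hU.le h.symm (by omega) hc.ge
    omega
  by_contra hne
  obtain ⟨b, hb, hbr, hbc⟩ := (U y).exists_of_le (r := (U x).row + 1) (s := (U x).col)
    (by omega) (by omega)
  obtain ⟨k, rfl⟩ := U.surjective b
  have h1 : x < k := hU.lt (h.trans hb.symm) (by omega) (by omega) (by omega)
  have h2 : k < y := hU.lt hb (by omega) (by omega) (by omega)
  omega

/-- The generic quotient specializes to the row and column eigenvalues q and -1, which lets the
special cases join the uniform formula. -/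
theorem diagCoeff_of_content_eq_add_one {b c : Box L} (h : b.comp = c.comp)
    (hbc : b.content = c.content + 1) : diagCoeff b c = -1 ∧ diagCoeff c b = q := by
  have h1 : (1 - q : K) ≠ 0 := sub_ne_zero.mpr q_ne_one.symm
  have h2 : (q - 1 : K) ≠ 0 := sub_ne_zero.mpr q_ne_one
  have hq := q_ne_zero
  constructor
  · rw [diagCoeff, if_pos h, show b.content - c.content = 1 by omega, zpow_one]
    field_simp
    ring
  · rw [diagCoeff, if_pos h.symm, show c.content - b.content = -1 by omega, zpow_neg_one]
    field_simp

theorem IsStandard.diagCoeff_row {U : Filling n L} (hU : IsStandard U) {x y : Fin n}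
    (hxy : x.val + 1 = y.val) (h : (U x).comp = (U y).comp) (hr : (U x).row = (U y).row) :
    diagCoeff (U x) (U y) = q ∧ diagCoeff (U y) (U x) = -1 := by
  have := hU.col_succ hxy h hr
  refine (diagCoeff_of_content_eq_add_one h.symm ?_).symm
  simp only [Box.content, h]
  omega

theorem IsStandard.diagCoeff_col {U : Filling n L} (hU : IsStandard U) {x y : Fin n}
    (hxy : x.val + 1 = y.val) (h : (U x).comp = (U y).comp) (hc : (U x).col = (U y).col) :
    diagCoeff (U x) (U y) = -1 ∧ diagCoeff (U y) (U x) = q := by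
  have := hU.row_succ hxy h hc
  refine diagCoeff_of_content_eq_add_one h ?_
  simp only [Box.content, h]
  omega

/-- Generically this is (1+a)(1+a') with a + a' = q-1; in a common row or column a a' = -q and both
sides are 0. -/
theorem IsStandard.swapCoeff_mul {U : Filling n L} (hU : IsStandard U) {x y : Fin n}
    (hxy : x.val + 1 = y.val) :
    swapCoeff (U x) (U y) * swapCoeff (U y) (U x) =
      diagCoeff (U x) (U y) * diagCoeff (U y) (U x) + q := by
  by_cases h : (U x).comp = (U y).comp ∧ ((U x).row = (U y).row ∨ (U x).col = (U y).col)
  · rw [swapCoeff, if_pos h, zero_mul]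
    obtain ⟨h, hr | hc⟩ := h
    · rw [(hU.diagCoeff_row hxy h hr).1, (hU.diagCoeff_row hxy h hr).2]
      ring
    · rw [(hU.diagCoeff_col hxy h hc).1, (hU.diagCoeff_col hxy h hc).2]
      ring
  · have h' : ¬ ((U y).comp = (U x).comp ∧ ((U y).row = (U x).row ∨ (U y).col = (U x).col)) := by
      simpa only [eq_comm] using h
    rw [swapCoeff, if_neg h, swapCoeff, if_neg h']
    have := diagCoeff_add (hU.offDiagonal (i := x) (j := y) (by omega) (by omega))
    linear_combination this

/-! ### The operators on basis vectors -/

/-- The filling with the entries `x` and `y` exchanged. -/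
abbrev swapped (x y : Fin n) (U : Filling n L) : Filling n L := (Equiv.swap x y).trans U

theorem isStandard_swapped {U : Filling n L} (hU : IsStandard U) {x y : Fin n}
    (hxy : x.val + 1 = y.val)
    (h : ¬ ((U x).comp = (U y).comp ∧ ((U x).row = (U y).row ∨ (U x).col = (U y).col))) :
    IsStandard (swapped x y U) := by
  -- An adjacent transposition reverses the order of the pair x, y only.
  have key : ∀ i j : Fin n, Equiv.swap x y i < Equiv.swap x y j → ¬ i < j → i = y ∧ j = x := by
    intro i j
    simp only [Equiv.swap_apply_def]
    split_ifs <;> omega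
  intro i j hij
  simp only [Equiv.trans_apply] at hij ⊢
  have h' := hU _ _ hij
  refine ⟨fun hr hc => ?_, fun hr hc => ?_⟩
  · by_contra hlt
    obtain ⟨rfl, rfl⟩ := key i j (h'.1 hr hc) hlt
    simp only [Equiv.swap_apply_left, Equiv.swap_apply_right] at hij hr
    exact h ⟨hij, Or.inl hr⟩
  · by_contra hlt
    obtain ⟨rfl, rfl⟩ := key i j (h'.2 hr hc) hlt
    simp only [Equiv.swap_apply_left, Equiv.swap_apply_right] at hij hr
    exact h ⟨hij, Or.inr hr⟩

theorem vec_of_standard {U : Filling n L} (h : IsStandard U) : vec U = Finsupp.single ⟨U, h⟩ 1 :=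
  dif_pos h

theorem vec_of_not_standard {U : Filling n L} (h : ¬ IsStandard U) : vec U = 0 := dif_neg h

theorem swapped_swapped (x y : Fin n) (U : Filling n L) : swapped x y (swapped x y U) = U := by
  ext i : 1
  simp

theorem opT_vec {i : Fin n} (x : Fin n) (hx : x.val + 1 = i.val) (U : Filling n L) :
    opT L i (vec U) =
      diagCoeff (U x) (U i) • vec U + swapCoeff (U x) (U i) • vec (swapped x i U) := by
  by_cases hU : IsStandard U
  · have hx' : (⟨i.val - 1, lt_of_le_of_lt (Nat.sub_le _ _) i.isLt⟩ : Fin n) = x := by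
      ext
      simp only
      omega
    have hT : opT L i (vec U) = seminormal x i U := by
      rw [vec_of_standard hU, ← hx']
      exact (Finsupp.linearCombination_single K 1 (⟨U, hU⟩ : StdBitableau n L)).trans (one_smul _ _)
    rw [hT]
    simp only [seminormal, swapCoeff]
    by_cases h : (U x).comp = (U i).comp
    · by_cases hr : (U x).row = (U i).row
      · simp [h, hr, (hU.diagCoeff_row hx h hr).1]
      · by_cases hc : (U x).col = (U i).col
        · simp [h, hr, hc, (hU.diagCoeff_col hx h hc).1]
        · simp [h, hr, hc, diagCoeff]
    · by_cases h0 : (U x).comp = 0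
      · have h' : ¬ 0 = (U i).comp := h0 ▸ h
        simp [h', h0, diagCoeff]
      · simp [h, h0, diagCoeff]
  -- The right side must vanish too. If the exchanged filling is standard, the two boxes share a row
  -- or column, and the 0 built into `swapCoeff` is what is needed.
  · rw [vec_of_not_standard hU, map_zero, smul_zero, zero_add]
    by_cases hs : IsStandard (swapped x i U)
    · have h : (U x).comp = (U i).comp ∧ ((U x).row = (U i).row ∨ (U x).col = (U i).col) := by
        by_contra h
        apply hU
        rw [← swapped_swapped x i U]
        exact isStandard_swapped hs hx (by simpa [eq_comm] using h)
      rw [swapCoeff, if_pos h, zero_smul]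
    · rw [vec_of_not_standard hs, smul_zero]

theorem opE_vec (h : 0 < n) (U : Filling n L) :
    opE L h (vec U) = (if (U ⟨0, h⟩).comp = 0 then (1 : K) else 0) • vec U := by
  by_cases hU : IsStandard U
  · have hE : opE L h (vec U) = if (U ⟨0, h⟩).comp = 0 then vec U else 0 := by
      conv_lhs => rw [vec_of_standard hU]
      exact (Finsupp.linearCombination_single K 1 (⟨U, hU⟩ : StdBitableau n L)).trans (one_smul _ _)
    rw [hE]
    split_ifs <;> simp
  · simp [vec_of_not_standard hU]

theorem end_ext {V : Type} [AddCommGroup V] [Module K V] {f g : M n L →ₗ[K] V}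
    (h : ∀ U : Filling n L, IsStandard U → f (vec U) = g (vec U)) : f = g := by
  refine Finsupp.lhom_ext' fun U => LinearMap.ext_ring ?_
  have := h U.1 U.2
  rw [vec_of_standard U.2] at this
  exact this

end Mirabolic

end

noncomputable section

namespace Mirabolic

variable {n : ℕ} {L : Bipartition}

/-! ### The module structure -/

/-- The operator by which the generator `T_i` acts, including `i = 0`. -/
def generatorOp (L : Bipartition) (i : Fin n) : Module.End K (M n L) :=
  if i.val = 0 then q • opE L i.pos - 1 else opT L i

theorem generatorOp_of_val_eq_zero {o : Fin n} (ho : o.val = 0) :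
    generatorOp L o = q • opE L o.pos - 1 := if_pos ho

theorem generatorOp_zero_vec {o : Fin n} (ho : o.val = 0) (U : Filling n L) :
    generatorOp L o (vec U) = (if (U o).comp = 0 then q - 1 else -1 : K) • vec U := by
  have : (⟨0, o.pos⟩ : Fin n) = o := Fin.ext ho.symm
  rw [generatorOp, if_pos ho, LinearMap.sub_apply, LinearMap.smul_apply, opE_vec, this,
    Module.End.one_apply]
  split_ifs
  · rw [one_smul, sub_smul, one_smul]
  · rw [zero_smul, smul_zero, zero_sub, neg_smul, one_smul]

theorem generatorOp_vec {i : Fin n} (x : Fin n) (hx : x.val + 1 = i.val) (U : Filling n L) :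
    generatorOp L i (vec U) =
      diagCoeff (U x) (U i) • vec U + swapCoeff (U x) (U i) • vec (swapped x i U) := by
  rw [generatorOp, if_neg (by omega), opT_vec x hx]

/-! ### Relations on spans of exchanged vectors, as scalar identities -/

section Identities

variable {F V : Type*} [Field F] [AddCommGroup V] [Module F V] {f g : Module.End F V}

theorem quad_apply {v w : V} {a a' b b' p r : F} (hv : f v = a • v + b • w)
    (hw : f w = a' • w + b' • v) (h₁ : a + a' = p) (h₂ : b * b' = a * a' + r) :
    f (f v) = p • f v + r • v := by
  simp only [hv, hw, map_add, map_smul]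
  linear_combination (norm := module) (a * h₁ + h₂) • v + (b * h₁) • w

/-- The w-coefficient is b(ac + a'c') = 0; the v-coefficient a²c + bb'c' reduces to rc'. The
eigenvalue passes from the exchanged vector w to v. -/
theorem jucysMurphy_apply {v w : V} {a a' b b' c c' r : F} (hv : f v = a • v + b • w)
    (hw : f w = a' • w + b' • v) (hgv : g v = c • v) (hgw : g w = c' • w)
    (h₁ : a * c + a' * c' = 0) (h₂ : b * b' = a * a' + r) :
    f (g (f v)) = r • c' • v := by
  simp only [hv, hw, hgv, hgw, map_add, map_smul]
  linear_combination (norm := module) (a * h₁ + c' * h₂) • v + (b * h₁) • w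

theorem comm_apply {v v₁ v₂ v₃ : V} {a b c d : F} (hf : f v = a • v + b • v₁)
    (hf' : f v₂ = a • v₂ + b • v₃) (hg : g v = c • v + d • v₂) (hg' : g v₁ = c • v₁ + d • v₃) :
    f (g v) = g (f v) := by
  simp only [hf, hf', hg, hg', map_add, map_smul]
  module

/-- The two mixed relations between the generators with indices `0` and `1`, applied to `v`. -/
def MixedRelations (p : F) (f g : Module.End F V) (v : V) : Prop :=
  f (g (f (g v))) = p • (g (f (g v)) + g (f v)) - f (g (f v)) ∧
    g (f (g (f v))) = p • (g (f (g v)) + f (g v)) - f (g (f v))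

theorem mixedRelations_of_scalar {v w : V} {a a' b b' p : F} (hv : g v = a • v + b • w)
    (hw : g w = a' • w + b' • v) (fv : f v = p • v) (fw : f w = p • w) :
    MixedRelations p f g v := by
  constructor <;> simp only [hv, hw, fv, fw, map_add, map_smul] <;> module

theorem mixedRelations_of_left {v w : V} {p : F} (hv : g v = w)
    (hw : g w = p • w + (p + 1) • v) (fv : f v = p • v) (fw : f w = -w) :
    MixedRelations p f g v := by
  constructor <;> simp only [hv, hw, fv, fw, map_add, map_smul, map_neg] <;> module

theorem mixedRelations_of_right {v w : V} {p : F} (hv : g v = p • v + (p + 1) • w)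
    (hw : g w = v) (fv : f v = -v) (fw : f w = p • w) :
    MixedRelations p f g v := by
  constructor <;> simp only [hv, hw, fv, fw, map_add, map_smul, map_neg] <;> module

theorem mixedRelations_of_neg {v : V} {p : F} (hv : g v = -v) (fv : f v = -v) :
    MixedRelations p f g v := by
  constructor <;> simp only [hv, fv, map_neg] <;> module

/-- Subscripts record the order of three boxes in consecutive entries; f exchanges the first two
places and g the last two. Only the coefficients of v₁₂₃, v₂₁₃ and v₁₃₂ need the hypotheses on the
scalars. -/
theorem braid_apply {v₁₂₃ v₂₁₃ v₁₃₂ v₃₁₂ v₂₃₁ v₃₂₁ : V} {a₁₂ a₂₁ a₁₃ a₂₃ a₃₂ g₁₂ g₂₁ g₁₃ g₂₃ g₃₂ p r : F}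
    (f₁ : f v₁₂₃ = a₁₂ • v₁₂₃ + g₁₂ • v₂₁₃) (f₂ : f v₂₁₃ = a₂₁ • v₂₁₃ + g₂₁ • v₁₂₃)
    (f₃ : f v₁₃₂ = a₁₃ • v₁₃₂ + g₁₃ • v₃₁₂) (f₄ : f v₂₃₁ = a₂₃ • v₂₃₁ + g₂₃ • v₃₂₁)
    (k₁ : g v₁₂₃ = a₂₃ • v₁₂₃ + g₂₃ • v₁₃₂) (k₂ : g v₁₃₂ = a₃₂ • v₁₃₂ + g₃₂ • v₁₂₃)
    (k₃ : g v₂₁₃ = a₁₃ • v₂₁₃ + g₁₃ • v₂₃₁) (k₄ : g v₃₁₂ = a₁₂ • v₃₁₂ + g₁₂ • v₃₂₁)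
    (h₁ : a₁₂ + a₂₁ = p) (h₂ : a₂₃ + a₃₂ = p) (h₃ : a₁₃ * (a₁₂ + a₂₃ - p) = a₁₂ * a₂₃)
    (h₄ : g₁₂ * g₂₁ = a₁₂ * a₂₁ + r) (h₅ : g₂₃ * g₃₂ = a₂₃ * a₃₂ + r) :
    f (g (f v₁₂₃)) = g (f (g v₁₂₃)) := by
  obtain rfl : a₂₁ = p - a₁₂ := eq_sub_of_add_eq' h₁
  obtain rfl : a₃₂ = p - a₂₃ := eq_sub_of_add_eq' h₂
  simp only [f₁, f₂, f₃, f₄, k₁, k₂, k₃, k₄, map_add, map_smul]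
  linear_combination (norm := module)
    (a₁₃ * h₄ - a₁₃ * h₅ - (a₁₂ - a₂₃) * h₃) • v₁₂₃ - (g₁₂ * h₃) • v₂₁₃ + (g₂₃ * h₃) • v₁₃₂

end Identities

/-! ### The defining relations for the seminormal operators -/

theorem generatorOp_quad {i : Fin n} (hi : 1 ≤ i.val) :
    generatorOp L i * generatorOp L i = (q - 1) • generatorOp L i + q • 1 := by
  obtain ⟨x, hx⟩ : ∃ x : Fin n, x.val + 1 = i.val := ⟨⟨i.val - 1, by omega⟩, by simp only; omega⟩
  refine end_ext fun U hU => ?_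
  refine quad_apply (generatorOp_vec x hx U) ((generatorOp_vec x hx (swapped x i U)).trans ?_)
    (diagCoeff_add (hU.offDiagonal (i := x) (j := i) (by omega) (by omega))) (hU.swapCoeff_mul hx)
  simp only [swapped_swapped, Equiv.trans_apply, Equiv.swap_apply_left, Equiv.swap_apply_right]

theorem generatorOp_braid {i j : Fin n} (hi : 1 ≤ i.val) (hj : j.val = i.val + 1) :
    generatorOp L i * generatorOp L j * generatorOp L i =
      generatorOp L j * generatorOp L i * generatorOp L j := by
  obtain ⟨x, hx⟩ : ∃ x : Fin n, x.val + 1 = i.val := ⟨⟨i.val - 1, by omega⟩, by simp only; omega⟩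
  have hxi : x ≠ i := by omega
  have hxj : x ≠ j := by omega
  have hij : i ≠ j := by omega
  refine end_ext fun U hU => ?_
  have o₁ := hU.offDiagonal (i := x) (j := i) (by omega) (by omega)
  have o₂ := hU.offDiagonal (i := i) (j := j) (by omega) (by omega)
  have o₃ := hU.offDiagonal (i := x) (j := j) (by omega) (by omega)
  -- The two reduced words of the longest permutation lead to the same v₃₂₁.
  have e : swapped i j (swapped x i (swapped i j U)) =
      swapped x i (swapped i j (swapped x i U)) := by
    ext k : 1
    simp only [Equiv.trans_apply, Equiv.swap_apply_def]
    congr 1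
    split_ifs <;> simp_all
  have k := fun W : Filling n L => generatorOp_vec x hx W
  have l := fun W : Filling n L => generatorOp_vec i hj.symm W
  have sx : Equiv.swap i j x = x := Equiv.swap_apply_of_ne_of_ne hxi hxj
  have sj : Equiv.swap x i j = j := Equiv.swap_apply_of_ne_of_ne hxj.symm hij.symm
  refine braid_apply (g₁₃ := swapCoeff (U x) (U j)) (v₃₁₂ := vec (swapped x i (swapped i j U)))
    (v₃₂₁ := vec (swapped x i (swapped i j (swapped x i U)))) (k U) ((k _).trans ?_)
    ((k (swapped i j U)).trans ?_)
    ((k (swapped i j (swapped x i U))).trans ?_)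
    (l U) ((l _).trans ?_) ((l _).trans ?_) ((l (swapped x i (swapped i j U))).trans ?_)
    (diagCoeff_add o₁) (diagCoeff_add o₂) (diagCoeff_triple o₁ o₂ o₃) (hU.swapCoeff_mul hx)
    (hU.swapCoeff_mul hj.symm) <;>
  simp only [e, swapped_swapped, Equiv.trans_apply, Equiv.swap_apply_left, Equiv.swap_apply_right,
    sx, sj]

theorem IsStandard.diagCoeff_of_comp_one {U : Filling n L}
    (hL : ∀ b : Box L, b.comp = 1 → b.col = 0) (hU : IsStandard U) {x y : Fin n}
    (hxy : x.val + 1 = y.val) (hx : (U x).comp = 1) (hy : (U y).comp = 1) :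
    diagCoeff (U x) (U y) = -1 ∧ swapCoeff (U x) (U y) = 0 := by
  have hc : (U x).col = (U y).col := (hL _ hx).trans (hL _ hy).symm
  exact ⟨(hU.diagCoeff_col hxy (hx.trans hy.symm) hc).1,
    if_pos ⟨hx.trans hy.symm, Or.inr hc⟩⟩

/-- On a line where T_0 acts by -1, the mixed relations force T_1 to act by 0 or -1. This rules out
the row eigenvalue q in the second component, hence the column hypothesis. -/
theorem generatorOp_mixed (hL : ∀ b : Box L, b.comp = 1 → b.col = 0) {o i : Fin n}
    (ho : o.val = 0) (hi : i.val = 1) :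
    generatorOp L o * generatorOp L i * generatorOp L o * generatorOp L i =
        (q - 1) • (generatorOp L i * generatorOp L o * generatorOp L i +
          generatorOp L i * generatorOp L o) -
        generatorOp L o * generatorOp L i * generatorOp L o ∧
      generatorOp L i * generatorOp L o * generatorOp L i * generatorOp L o =
        (q - 1) • (generatorOp L i * generatorOp L o * generatorOp L i +
          generatorOp L o * generatorOp L i) -
        generatorOp L o * generatorOp L i * generatorOp L o := by
  have hoi : o.val + 1 = i.val := by omega
  have key : ∀ U : Filling n L, IsStandard U →
      MixedRelations (q - 1) (generatorOp L o) (generatorOp L i) (vec U) := by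
    intro U hU
    have hv := generatorOp_vec o hoi U
    have hw := generatorOp_vec o hoi (swapped o i U)
    have fv := generatorOp_zero_vec ho U
    have fw := generatorOp_zero_vec ho (swapped o i U)
    simp only [swapped_swapped, Equiv.trans_apply, Equiv.swap_apply_left,
      Equiv.swap_apply_right] at hw fw
    rcases fin_two_cases (U o).comp with hb | hb <;> rcases fin_two_cases (U i).comp with hc | hc
    · rw [if_pos hb] at fv
      rw [if_pos hc] at fw
      exact mixedRelations_of_scalar hv hw fv fw
    · simp only [hb, hc, diagCoeff, swapCoeff, zero_ne_one, one_ne_zero, if_true, if_false,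
        false_and, zero_smul, zero_add, add_zero, neg_smul, one_smul] at hv hw fv fw
      exact mixedRelations_of_left hv (by rw [hw, add_comm 1 (q - 1)]) fv fw
    · simp only [hb, hc, diagCoeff, swapCoeff, zero_ne_one, one_ne_zero, if_true, if_false,
        false_and, zero_smul, zero_add, add_zero, neg_smul, one_smul] at hv hw fv fw
      exact mixedRelations_of_right (by rw [hv, add_comm 1 (q - 1)]) hw fv fw
    · obtain ⟨h1, h2⟩ := hU.diagCoeff_of_comp_one hL hoi hb hc
      rw [h1, h2, zero_smul, add_zero, neg_smul, one_smul] at hv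
      rw [if_neg (by rw [hb]; exact one_ne_zero), neg_smul, one_smul] at fv
      exact mixedRelations_of_neg hv fv
  exact ⟨end_ext fun U hU => (key U hU).1, end_ext fun U hU => (key U hU).2⟩

theorem swapped_comm {x i y j : Fin n} (hxy : x ≠ y) (hxj : x ≠ j) (hiy : i ≠ y) (hij : i ≠ j)
    (U : Filling n L) : swapped x i (swapped y j U) = swapped y j (swapped x i U) := by
  ext k : 1
  simp only [Equiv.trans_apply, Equiv.swap_apply_def]
  congr 1
  split_ifs <;> simp_all

theorem generatorOp_comm {i j : Fin n} (h : i.val + 2 ≤ j.val) :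
    generatorOp L i * generatorOp L j = generatorOp L j * generatorOp L i := by
  obtain ⟨y, hy⟩ : ∃ y : Fin n, y.val + 1 = j.val := ⟨⟨j.val - 1, by omega⟩, by simp only; omega⟩
  have hiy : i ≠ y := by omega
  have hij : i ≠ j := by omega
  have si : Equiv.swap y j i = i := Equiv.swap_apply_of_ne_of_ne hiy hij
  refine end_ext fun U _ => ?_
  by_cases hi : i.val = 0
  · simp only [Module.End.mul_apply, map_add, map_smul, generatorOp_vec y hy,
      generatorOp_zero_vec hi, Equiv.trans_apply, si, smul_add,
      smul_comm (if (U i).comp = 0 then q - 1 else -1 : K)]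
  · obtain ⟨x, hx⟩ : ∃ x : Fin n, x.val + 1 = i.val :=
      ⟨⟨i.val - 1, by omega⟩, by simp only; omega⟩
    have hxy : x ≠ y := by omega
    have hxj : x ≠ j := by omega
    have sx : Equiv.swap y j x = x := Equiv.swap_apply_of_ne_of_ne hxy hxj
    have sy : Equiv.swap x i y = y := Equiv.swap_apply_of_ne_of_ne hxy.symm hiy.symm
    have sj : Equiv.swap x i j = j := Equiv.swap_apply_of_ne_of_ne hxj.symm hij.symm
    refine comm_apply (v₃ := vec (swapped x i (swapped y j U))) (generatorOp_vec x hx U)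
      ((generatorOp_vec x hx (swapped y j U)).trans ?_) (generatorOp_vec y hy U)
      ((generatorOp_vec y hy (swapped x i U)).trans ?_)
    · simp only [Equiv.trans_apply, si, sx]
    · simp only [Equiv.trans_apply, sy, sj, swapped_comm hxy hxj hiy hij]

theorem exists_algHom_generatorOp (n : ℕ) (hL : ∀ b : Box L, b.comp = 1 → b.col = 0) :
    ∃ ρ : R n →ₐ[K] Module.End K (M n L), ∀ i, ρ (T i) = generatorOp L i := by
  refine ⟨RingQuot.liftAlgHom K ⟨FreeAlgebra.lift K (generatorOp L), ?_⟩, fun i => ?_⟩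
  · intro x y hxy
    have hl : ∀ i : Fin n, FreeAlgebra.lift K (generatorOp L) (t i) = generatorOp L i :=
      fun i => FreeAlgebra.lift_ι_apply _ _
    cases hxy with
    | zero_sq o ho =>
      simp only [map_mul, map_add, map_smul, map_one, hl]
      refine end_ext fun U _ => ?_
      simp only [Module.End.mul_apply, LinearMap.add_apply, LinearMap.smul_apply, map_smul,
        Module.End.one_apply, generatorOp_zero_vec ho]
      rw [smul_smul, smul_smul, ← add_smul]
      split_ifs <;> congr 1 <;> ring
    | quad i hi => simpa only [map_mul, map_add, map_smul, map_one, hl] using generatorOp_quad hi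
    | braid i j hi hj => simpa only [map_mul, hl] using generatorOp_braid hi hj
    | mixed o i ho hi =>
      simpa only [map_mul, map_add, map_sub, map_smul, hl] using (generatorOp_mixed hL ho hi).1
    | mixed' o i ho hi =>
      simpa only [map_mul, map_add, map_sub, map_smul, hl] using (generatorOp_mixed hL ho hi).2
    | comm i j h => simpa only [map_mul, hl] using generatorOp_comm h
  · rw [T, RingQuot.liftAlgHom_mkAlgHom_apply, FreeAlgebra.lift_ι_apply]

theorem isSeminormal_iff {ρ : R n →ₐ[K] Module.End K (M n L)} :
    IsSeminormal ρ ↔ ∀ i, ρ (T i) = generatorOp L i := by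
  have he : ∀ h : 0 < n, ρ (e h) = q⁻¹ • (ρ (T ⟨0, h⟩) + 1) := fun h => by
    rw [e, map_smul, map_add, map_one]
  have hT : ∀ h : 0 < n, ρ (T ⟨0, h⟩) = q • ρ (e h) - 1 := fun h => by
    rw [he, smul_inv_smul₀ q_ne_zero]
    exact LinearMap.ext fun v => (add_sub_cancel_right (ρ (T ⟨0, h⟩) v) v).symm
  constructor
  · intro hρ i
    by_cases hi : i.val = 0
    · have hi' : i = ⟨0, i.pos⟩ := Fin.ext hi
      rw [generatorOp_of_val_eq_zero hi, ← hρ.1, ← hT, ← hi']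
    · rw [generatorOp, if_neg hi, hρ.2 i (by omega)]
  · refine fun hρ => ⟨fun h => ?_, fun i hi => ?_⟩
    · have := hT h
      rw [hρ, generatorOp_of_val_eq_zero rfl] at this
      refine LinearMap.ext fun v => ?_
      have h' : q • opE L h v - v = q • ρ (e h) v - v := LinearMap.congr_fun this v
      exact (smul_right_injective _ q_ne_zero (sub_left_injective h')).symm
    · rw [hρ, generatorOp, if_neg (by omega)]

theorem existsUnique_isSeminormal (n : ℕ) (hL : ∀ b : Box L, b.comp = 1 → b.col = 0) :
    ∃! ρ : R n →ₐ[K] Module.End K (M n L), IsSeminormal ρ := by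
  obtain ⟨ρ, hρ⟩ := exists_algHom_generatorOp n hL
  refine ⟨ρ, isSeminormal_iff.mpr hρ, fun σ hσ => ?_⟩
  refine RingQuot.ringQuot_ext' K σ ρ (FreeAlgebra.hom_ext (funext fun i => ?_))
  exact (isSeminormal_iff.mp hσ i).trans (hρ i).symm

theorem R.induction {p : R n → Prop} (algebraMap : ∀ c : K, p (algebraMap K (R n) c))
    (gen : ∀ i, p (T i)) (add : ∀ x y, p x → p y → p (x + y)) (mul : ∀ x y, p x → p y → p (x * y))
    (x : R n) : p x := by
  obtain ⟨y, rfl⟩ := RingQuot.mkAlgHom_surjective K (Rel n) x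
  induction y using FreeAlgebra.induction with
  | grade0 c => simpa using algebraMap c
  | grade1 i => exact gen i
  | mul a b ha hb => rw [map_mul]; exact mul _ _ ha hb
  | add a b ha hb => rw [map_add]; exact add _ _ ha hb

/-! ### Jucys–Murphy elements -/

/-- All fillings are allowed because the induction hypothesis is applied to the exchanged filling,
which may be nonstandard; both sides are then 0. -/
theorem IsSeminormal.JM_vec {ρ : R n →ₐ[K] Module.End K (M n L)} (hρ : IsSeminormal ρ) (i : ℕ)
    (h : i < n) (U : Filling n L) : ρ (JM i h) (vec U) = weight (U ⟨i, h⟩) • vec U := by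
  induction i generalizing U with
  | zero =>
    rw [JM, hρ.1, opE_vec, weight]
    by_cases hU : IsStandard U
    · by_cases h0 : (U ⟨0, h⟩).comp = 0
      -- The smallest entry sits in a corner of content 0, so its weight is 1, the eigenvalue of e.
      · have hz : ((U ⟨0, h⟩).row = 0 ∧ (U ⟨0, h⟩).col = 0) := by
          obtain ⟨b, hb, hr, hc⟩ := (U ⟨0, h⟩).exists_of_le (Nat.zero_le _) (Nat.zero_le _)
          obtain ⟨k, rfl⟩ := U.surjective b
          by_contra hne
          have := hU.lt (i := k) (j := ⟨0, h⟩) hb (by omega) (by omega) (by omega)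
          exact absurd this (by simp [Fin.lt_def])
        simp [h0, hz, Box.content]
      · simp [h0]
    · simp [vec_of_not_standard hU]
  | succ i ih =>
    by_cases hU : IsStandard U
    · have hi : (⟨i, Nat.lt_of_succ_lt h⟩ : Fin n).val + 1 = (⟨i + 1, h⟩ : Fin n).val := rfl
      have o := hU.offDiagonal (i := ⟨i, Nat.lt_of_succ_lt h⟩) (j := ⟨i + 1, h⟩)
        (by simp [Fin.lt_def]) (by simp)
      have hT := isSeminormal_iff.mp hρ ⟨i + 1, h⟩
      rw [JM, map_smul, map_mul, map_mul, isSeminormal_iff.mp hρ ⟨i + 1, h⟩, LinearMap.smul_apply,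
        inv_smul_eq_iff₀ q_ne_zero]
      refine jucysMurphy_apply (generatorOp_vec _ hi U)
        ((generatorOp_vec _ hi (swapped ⟨i, Nat.lt_of_succ_lt h⟩ ⟨i + 1, h⟩ U)).trans ?_)
        (ih _ U) ((ih _ _).trans ?_) (diagCoeff_mul_weight o) (hU.swapCoeff_mul hi) <;>
      simp only [swapped_swapped, Equiv.trans_apply, Equiv.swap_apply_left, Equiv.swap_apply_right]
    · simp [vec_of_not_standard hU]

theorem IsSeminormal.JM_apply {ρ : R n →ₐ[K] Module.End K (M n L)} (hρ : IsSeminormal ρ) (i : ℕ)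
    (h : i < n) (f : M n L) (V : StdBitableau n L) :
    ρ (JM i h) f V = weight (V.1 ⟨i, h⟩) * f V := by
  have key : Finsupp.lapply V ∘ₗ ρ (JM i h) =
      weight (V.1 ⟨i, h⟩) • (Finsupp.lapply V : M n L →ₗ[K] K) := by
    refine end_ext fun U hU => ?_
    rw [LinearMap.comp_apply, hρ.JM_vec, map_smul, LinearMap.smul_apply, vec_of_standard hU]
    by_cases hUV : V = ⟨U, hU⟩
    · rw [hUV]
    · have h0 : (Finsupp.single (⟨U, hU⟩ : StdBitableau n L) (1 : K)) V = 0 :=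
        Finsupp.single_eq_of_ne hUV
      change _ • (Finsupp.single (⟨U, hU⟩ : StdBitableau n L) (1 : K)) V =
        _ • (Finsupp.single (⟨U, hU⟩ : StdBitableau n L) (1 : K)) V
      rw [h0, smul_zero, smul_zero]
  exact LinearMap.congr_fun key f

end Mirabolic

end

noncomputable section

namespace Mirabolic

variable {n : ℕ} {L : Bipartition}

/-! ### Irreducibility -/

/-- Powers of q are nonzero, so the weight detects the component. Two boxes on one diagonal, or in
one column, are comparable. -/
theorem comparable_of_weight_eq (hL : ∀ b : Box L, b.comp = 1 → b.col = 0) {b c : Box L}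
    (h : weight b = weight c) :
    b.comp = c.comp ∧ (b.row ≤ c.row ∧ b.col ≤ c.col ∨ c.row ≤ b.row ∧ c.col ≤ b.col) := by
  have hq : ∀ d : ℤ, (q ^ d : K) ≠ 0 := fun d => zpow_ne_zero d q_ne_zero
  rcases fin_two_cases b.comp with hb | hb <;> rcases fin_two_cases c.comp with hc | hc
  · rw [weight, weight, if_pos hb, if_pos hc] at h
    have := (Box.content_eq_iff (hb.trans hc.symm)).mp (q_zpow_inj h)
    exact ⟨hb.trans hc.symm, by omega⟩
  · simp [weight, hb, hc, hq] at h
  · simp [weight, hb, hc, (hq _).symm] at h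
  · have h1 := hL b hb
    have h2 := hL c hc
    exact ⟨hb.trans hc.symm, by omega⟩

/-- In V the box `U i` holds some j ≤ i, and j < i would put both j and i in that box of U. -/
theorem IsStandard.apply_eq_of_le {U V : Filling n L} (hV : IsStandard V) {i : Fin n}
    (ih : ∀ j < i, U j = V j) (h : (U i).comp = (V i).comp) (hr : (U i).row ≤ (V i).row)
    (hc : (U i).col ≤ (V i).col) : U i = V i := by
  obtain ⟨j, hj⟩ := V.surjective (U i)
  rw [← hj] at h hr hc
  rcases (hV.le h hr hc).eq_or_lt with rfl | hlt
  · exact hj.symm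
  · exact absurd (U.injective ((ih j hlt).trans hj)) hlt.ne

theorem eq_of_weight_eq (hL : ∀ b : Box L, b.comp = 1 → b.col = 0) {U V : Filling n L}
    (hU : IsStandard U) (hV : IsStandard V) (h : ∀ i, weight (U i) = weight (V i)) : U = V := by
  refine Equiv.ext fun i => ?_
  induction i using WellFoundedLT.induction with
  | ind i ih =>
    obtain ⟨hc, h1 | h1⟩ := comparable_of_weight_eq hL (h i)
    · exact hV.apply_eq_of_le ih hc h1.1 h1.2
    · exact (hU.apply_eq_of_le (fun j hj => (ih j hj).symm) hc.symm h1.1 h1.2).symm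

theorem eq_refl_of_lt_of_succ {σ : Equiv.Perm (Fin n)}
    (h : ∀ x y : Fin n, x.val + 1 = y.val → σ x < σ y) : σ = Equiv.refl _ := by
  have hσ : StrictMono σ := by
    cases n with
    | zero => exact fun a => a.elim0
    | succ n => exact Fin.strictMono_iff_lt_succ.mpr fun i => h _ _ (by simp)
  have := Subsingleton.elim (hσ.orderIsoOfSurjective σ σ.surjective) (OrderIso.refl _)
  exact Equiv.ext fun i => DFunLike.congr_fun this i

/-- The sum grows by exactly (y - x)(σ x - σ y). -/
theorem sum_mul_lt_sum_mul_swap {σ : Equiv.Perm (Fin n)} {x y : Fin n} (hxy : x < y)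
    (h : σ y < σ x) :
    ∑ i, (i.val : ℤ) * (σ i).val < ∑ i, (i.val : ℤ) * (σ (Equiv.swap x y i)).val := by
  rw [← sub_pos, ← Equiv.sum_comp (Equiv.swap x y) (fun i => (i.val : ℤ) * (σ (Equiv.swap x y i)).val),
    ← Finset.sum_sub_distrib, Fintype.sum_eq_add x y hxy.ne]
  · simp only [Equiv.swap_apply_left, Equiv.swap_apply_right]
    have h1 : (0 : ℤ) < y.val - x.val := by omega
    have h2 : (0 : ℤ) < (σ x).val - (σ y).val := by omega
    linear_combination mul_pos h1 h2
  · rintro i ⟨hx, hy⟩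
    simp [Equiv.swap_apply_of_ne_of_ne hx hy]

/-- Any two standard bitableaux are connected by exchanges of consecutive entries through standard
bitableaux. -/
theorem IsStandard.connected {P : Filling n L → Prop}
    (step : ∀ (U : Filling n L) (x y : Fin n), IsStandard U → P U → x.val + 1 = y.val →
      ¬ ((U x).comp = (U y).comp ∧ ((U x).row = (U y).row ∨ (U x).col = (U y).col)) →
      P (swapped x y U))
    {U V : Filling n L} (hU : IsStandard U) (hV : IsStandard V) (hP : P U) : P V := by
  have : Finite (Box L) := Finite.of_equiv _ U
  have : Nonempty {W : Filling n L // IsStandard W ∧ P W} := ⟨⟨U, hU, hP⟩⟩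
  -- Take W maximizing ∑ i·(V⁻¹W)(i). At a descent of V⁻¹W the two boxes of W share no row or
  -- column, since V is standard, so an exchange would raise the sum. Without descents W = V.
  obtain ⟨⟨W, hW, hPW⟩, hmax⟩ := Finite.exists_max
    fun W : {W : Filling n L // IsStandard W ∧ P W} =>
      ∑ i, (i.val : ℤ) * ((W.1.trans V.symm) i).val
  suffices h : W.trans V.symm = Equiv.refl _ by
    have : W = V := Equiv.ext fun i => by
      simpa using congrArg V (DFunLike.congr_fun h i)
    exact this ▸ hPW
  refine eq_refl_of_lt_of_succ fun x y hxy => ?_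
  by_contra hlt
  have hlt' : (W.trans V.symm) y < (W.trans V.symm) x := by
    refine lt_of_le_of_ne (not_lt.mp hlt) fun h => ?_
    have := (W.trans V.symm).injective h
    omega
  have hinc : ¬ ((W x).comp = (W y).comp ∧
      ((W x).row = (W y).row ∨ (W x).col = (W y).col)) := by
    rintro ⟨h, hr | hc⟩
    · have := hW.col_succ hxy h hr
      exact hlt (hV.lt (by simpa using h) (by simp [hr]) (by simp; omega) (by simp; omega))
    · have := hW.row_succ hxy h hc
      exact hlt (hV.lt (by simpa using h) (by simp; omega) (by simp [hc]) (by simp; omega))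
  exact absurd (hmax ⟨_, isStandard_swapped hW hxy hinc, step W x y hW hPW hxy hinc⟩)
    (not_le.mpr (sum_mul_lt_sum_mul_swap (by omega) hlt'))

theorem IsStandard.swapCoeff_ne_zero {U : Filling n L} (hU : IsStandard U) {x y : Fin n}
    (hxy : x.val + 1 = y.val)
    (hne : ¬ ((U x).comp = (U y).comp ∧ ((U x).row = (U y).row ∨ (U x).col = (U y).col))) :
    swapCoeff (U x) (U y) ≠ 0 := by
  rw [swapCoeff, if_neg hne]
  by_cases h : (U x).comp = (U y).comp
  · have h1 := one_sub_q_zpow_ne (hU.offDiagonal (i := x) (j := y) (by omega) (by omega) h)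
    rw [diagCoeff_same h, one_add_div h1, Ne, div_eq_zero_iff, not_or]
    refine ⟨fun h2 => ?_, h1⟩
    -- If 1 + a = 0, the box of x has content one more than that of y; the box in the row of y and
    -- column of x then holds an entry strictly between x and y.
    have h3 : (q ^ ((U y).content + 1) : K) = q ^ (U x).content := by
      rw [zpow_add_one₀ q_ne_zero]
      linear_combination h2
    have h4 := q_zpow_inj h3
    simp only [Box.content, h] at h4
    rw [not_and_or, not_or] at hne
    have hne := hne.resolve_left (not_not.mpr h)
    have h5 : (U x).row < (U y).row ∨ (U x).col < (U y).col := by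
      by_contra h5
      have := hU.le h.symm (by omega) (by omega)
      omega
    obtain ⟨b, hb, hr, hc⟩ := (U y).exists_of_le (r := (U y).row) (s := (U x).col)
      le_rfl (by omega)
    obtain ⟨k, rfl⟩ := U.surjective b
    have h6 : x < k := hU.lt (h.trans hb.symm) (by omega) (by omega) (by omega)
    have h7 : k < y := hU.lt hb (by omega) (by omega) (by omega)
    omega
  · rw [diagCoeff, if_neg h]
    split_ifs
    · simp
    · simpa using q_ne_zero

/-- If U and V both occur in f, subtracting from some L_i its eigenvalue at V kills the
V-coordinate, keeps U and creates no new terms: the support shrinks. -/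
theorem exists_vec_mem (hL : ∀ b : Box L, b.comp = 1 → b.col = 0)
    {ρ : R n →ₐ[K] Module.End K (M n L)} (hρ : IsSeminormal ρ) {W : Submodule K (M n L)}
    (hW : ∀ r : R n, ∀ w ∈ W, ρ r w ∈ W) (f : M n L) (hf : f ∈ W) (h0 : f ≠ 0) :
    ∃ U : Filling n L, IsStandard U ∧ vec U ∈ W := by
  induction hm : f.support.card using Nat.strong_induction_on generalizing f with
  | _ m ih =>
    obtain ⟨U, hU⟩ := Finsupp.ne_iff.mp h0
    rw [Finsupp.zero_apply] at hU
    by_cases h : ∃ V, f V ≠ 0 ∧ V ≠ U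
    · obtain ⟨V, hV, hVU⟩ := h
      obtain ⟨i, hi⟩ : ∃ i, weight (U.1 i) ≠ weight (V.1 i) := by
        by_contra! hall
        exact hVU (Subtype.ext (eq_of_weight_eq hL U.2 V.2 hall).symm)
      have hg : ∀ X, (ρ (JM i.val i.isLt) f - weight (V.1 i) • f) X =
          (weight (X.1 i) - weight (V.1 i)) * f X := fun X => by
        rw [Finsupp.sub_apply, Finsupp.smul_apply, hρ.JM_apply, smul_eq_mul, sub_mul]
      refine ih _ ?_ (ρ (JM i.val i.isLt) f - weight (V.1 i) • f)
        (W.sub_mem (hW _ _ hf) (W.smul_mem _ hf)) ?_ rfl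
      · rw [← hm]
        refine Finset.card_lt_card (Finset.ssubset_iff_of_subset ?_ |>.mpr ⟨V, ?_, ?_⟩)
        · intro X
          rw [Finsupp.mem_support_iff, Finsupp.mem_support_iff, hg]
          exact right_ne_zero_of_mul
        · exact Finsupp.mem_support_iff.mpr hV
        · rw [Finsupp.notMem_support_iff, hg, sub_self, zero_mul]
      · refine Finsupp.ne_iff.mpr ⟨U, ?_⟩
        rw [hg, Finsupp.zero_apply]
        exact mul_ne_zero (sub_ne_zero.mpr hi) hU
    · push Not at h
      refine ⟨U.1, U.2, ?_⟩
      have : vec U.1 = (f U)⁻¹ • f := by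
        rw [vec_of_standard U.2]
        refine Finsupp.ext fun X => ?_
        rw [Finsupp.smul_apply, smul_eq_mul]
        by_cases hX : X = U
        · rw [hX, inv_mul_cancel₀ hU]
          exact Finsupp.single_eq_same
        · rw [not_imp_comm.mp (h X) hX, mul_zero]
          exact Finsupp.single_eq_of_ne hX
      rw [this]
      exact W.smul_mem _ hf

theorem IsSeminormal.isIrreducible (hL : ∀ b : Box L, b.comp = 1 → b.col = 0)
    (hex : ∃ U : Filling n L, IsStandard U) {ρ : R n →ₐ[K] Module.End K (M n L)}
    (hρ : IsSeminormal ρ) : IsIrreducible ρ := by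
  obtain ⟨U₀, hU₀⟩ := hex
  have : Nonempty (StdBitableau n L) := ⟨⟨U₀, hU₀⟩⟩
  refine ⟨inferInstance, fun W hW => or_iff_not_imp_left.mpr fun hne => ?_⟩
  obtain ⟨f, hf, h0⟩ := W.exists_mem_ne_zero_of_ne_bot hne
  obtain ⟨U, hU, hUW⟩ := exists_vec_mem hL hρ hW f hf h0
  have hall : ∀ V : Filling n L, IsStandard V → vec V ∈ W := fun V hV => by
    refine IsStandard.connected (P := fun X => vec X ∈ W) (fun X x y hX hXW hxy hinc => ?_)
      hU hV hUW
    have h1 := hW (T y) _ hXW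
    rw [isSeminormal_iff.mp hρ, generatorOp_vec x hxy] at h1
    have h2 := (W.add_mem_iff_right (W.smul_mem _ hXW)).mp h1
    exact (W.smul_mem_iff (hX.swapCoeff_ne_zero hxy hinc)).mp h2
  refine (Submodule.eq_top_iff').mpr fun f => ?_
  induction f using Finsupp.induction_linear with
  | zero => exact W.zero_mem
  | add f g hf hg => exact W.add_mem hf hg
  | single V c =>
    have h1 := W.smul_mem c (hall V.1 V.2)
    rw [vec_of_standard V.2] at h1
    have h2 : c • Finsupp.single V (1 : K) = Finsupp.single V c := by
      rw [Finsupp.smul_single, smul_eq_mul, mul_one]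
    exact h2 ▸ h1

theorem exists_isStandard [Fintype (Box L)] (h : Fintype.card (Box L) = n) :
    ∃ U : Filling n L, IsStandard U := by
  -- Number the boxes row by row, the first diagram before the second.
  let key : Box L → Fin 2 ×ₗ (ℕ ×ₗ ℕ) := fun b => toLex (b.comp, toLex (b.row, b.col))
  have hkey : Function.Injective key := fun b c hbc => by
    simp only [key, EmbeddingLike.apply_eq_iff_eq, Prod.mk.injEq] at hbc
    exact Box.ext hbc.1 hbc.2.1 hbc.2.2
  let r := Equiv.ofInjective key hkey
  let o := Fintype.orderIsoFinOfCardEq (Set.range key) ((Fintype.card_congr r.symm).trans h)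
  have ho : ∀ i, key (r.symm (o i)) = o i := fun i => Equiv.apply_ofInjective_symm hkey _
  refine ⟨o.toEquiv.trans r.symm, fun i j hij => ⟨fun hr hc => ?_, fun hc hr => ?_⟩⟩ <;>
  · refine o.lt_iff_lt.mp (Subtype.coe_lt_coe.mp ?_)
    rw [← ho, ← ho]
    simp only [key, Prod.Lex.toLex_lt_toLex]
    exact Or.inr ⟨hij, by first | exact Or.inl hr | exact Or.inr ⟨hr, hc⟩⟩

/-! ### Eigenspaces of the last Jucys–Murphy element -/

theorem IsSeminormal.lastJM_sub_pow_apply {ρ : R (n + 1) →ₐ[K] Module.End K (M (n + 1) L)}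
    (hρ : IsSeminormal ρ) (α : K) (m : ℕ) (f : M (n + 1) L) (V : StdBitableau (n + 1) L) :
    ((ρ (lastJM n) - α • 1) ^ m) f V = (weight (V.1 (Fin.last n)) - α) ^ m * f V := by
  induction m generalizing f with
  | zero => simp
  | succ m ih =>
    rw [pow_succ, Module.End.mul_apply, ih, LinearMap.sub_apply, Finsupp.sub_apply, lastJM,
      hρ.JM_apply, LinearMap.smul_apply, Finsupp.smul_apply, Module.End.one_apply, smul_eq_mul,
      pow_succ]
    change _ * (weight (V.1 (Fin.last n)) * f V - _) = _
    ring

/-- L is diagonal on the v_V, so exponent 1 already suffices. -/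
theorem IsSeminormal.mem_jmSpace {ρ : R (n + 1) →ₐ[K] Module.End K (M (n + 1) L)}
    (hρ : IsSeminormal ρ) {α : K} {f : M (n + 1) L} :
    f ∈ jmSpace ρ α ↔ ∀ V, f V ≠ 0 → weight (V.1 (Fin.last n)) = α := by
  rw [jmSpace, Module.End.mem_maxGenEigenspace]
  constructor
  · rintro ⟨m, hm⟩ V hV
    have h := hρ.lastJM_sub_pow_apply α m f V
    rw [hm, Finsupp.zero_apply, eq_comm, mul_eq_zero] at h
    exact sub_eq_zero.mp (eq_zero_of_pow_eq_zero (h.resolve_right hV))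
  · refine fun h => ⟨1, Finsupp.ext fun V => ?_⟩
    rw [hρ.lastJM_sub_pow_apply, Finsupp.zero_apply, mul_eq_zero, pow_one, sub_eq_zero]
    exact or_iff_not_imp_right.mpr (h V)

theorem IsSeminormal.jmSpace_eq_eigenspace {ρ : R (n + 1) →ₐ[K] Module.End K (M (n + 1) L)}
    (hρ : IsSeminormal ρ) (α : K) : jmSpace ρ α = (ρ (lastJM n)).eigenspace α := by
  ext f
  rw [hρ.mem_jmSpace, Module.End.mem_eigenspace_iff]
  have h : ∀ V, ρ (lastJM n) f V = weight (V.1 (Fin.last n)) * f V := hρ.JM_apply n _ f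
  constructor
  · refine fun hf => Finsupp.ext fun V => ?_
    rw [h, Finsupp.smul_apply, smul_eq_mul]
    by_cases hV : f V = 0
    · rw [hV, mul_zero, mul_zero]
    · rw [hf V hV]
  · intro hf V hV
    have h1 := h V
    rw [hf, Finsupp.smul_apply, smul_eq_mul] at h1
    exact (mul_right_cancel₀ hV h1).symm

theorem IsSeminormal.jmSpace_eq_bot {ρ : R (n + 1) →ₐ[K] Module.End K (M (n + 1) L)}
    (hρ : IsSeminormal ρ) {α : K}
    (h : ∀ V : Filling (n + 1) L, IsStandard V → weight (V (Fin.last n)) ≠ α) :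
    jmSpace ρ α = ⊥ := by
  refine (Submodule.eq_bot_iff _).mpr fun f hf => Finsupp.ext fun V => ?_
  by_contra hV
  exact h V.1 V.2 (hρ.mem_jmSpace.mp hf V hV)

end Mirabolic

end

noncomputable section

namespace Mirabolic

variable {n : ℕ} {L L' : Bipartition}

/-! ### Removing the box of the largest entry -/

/-- The bipartition `L'` is obtained from `L` by removing the box `b₀`. -/
def IsRemoval (L' L : Bipartition) (b₀ : Box L) : Prop :=
  ∀ b : Fin 2 × ℕ × ℕ, b.2 ∈ L' b.1 ↔ b.2 ∈ L b.1 ∧ b ≠ b₀.1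

namespace IsRemoval

variable {b₀ : Box L}

/-- The inclusion of the boxes of `L'` into those of `L`. -/
def liftBox (h : IsRemoval L' L b₀) (b : Box L') : Box L := ⟨b.1, ((h b.1).mp b.2).1⟩

theorem liftBox_injective (h : IsRemoval L' L b₀) : Function.Injective h.liftBox :=
  fun _ _ hbc => Subtype.ext (congrArg (fun b : Box L => b.1) hbc)

theorem liftBox_ne (h : IsRemoval L' L b₀) (b : Box L') : h.liftBox b ≠ b₀ :=
  fun hb => ((h b.1).mp b.2).2 (congrArg Subtype.val hb)

theorem exists_liftBox_eq (h : IsRemoval L' L b₀) {b : Box L} (hb : b ≠ b₀) :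
    ∃ c, h.liftBox c = b :=
  ⟨⟨b.1, (h b.1).mpr ⟨b.2, fun h' => hb (Subtype.ext h')⟩⟩, rfl⟩

/-- Any other box beyond b₀ would survive in L', and L', being closed downwards, would then contain
b₀. -/
theorem eq_of_le (h : IsRemoval L' L b₀) {b : Box L} (hc : b₀.comp = b.comp)
    (hr : b₀.row ≤ b.row) (hcol : b₀.col ≤ b.col) : b = b₀ := by
  by_contra hne
  obtain ⟨c, rfl⟩ := h.exists_liftBox_eq hne
  obtain ⟨d, h1, h2, h3⟩ := c.exists_of_le hr hcol
  exact h.liftBox_ne d (Box.ext (h1.trans hc.symm) h2 h3)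

/-- The filling of `L` that extends a filling of `L'` by the largest entry in the box `b₀`. -/
def extend (h : IsRemoval L' L b₀) (U : Filling n L') : Filling (n + 1) L :=
  Equiv.ofBijective (Fin.lastCases (motive := fun _ => Box L) b₀ fun i => h.liftBox (U i)) <| by
    constructor
    · intro i j hij
      induction i using Fin.lastCases <;> induction j using Fin.lastCases
      · rfl
      · simp only [Fin.lastCases_last, Fin.lastCases_castSucc] at hij
        exact absurd hij.symm (h.liftBox_ne _)
      · simp only [Fin.lastCases_last, Fin.lastCases_castSucc] at hij
        exact absurd hij (h.liftBox_ne _)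
      · simp only [Fin.lastCases_castSucc] at hij
        rw [U.injective (h.liftBox_injective hij)]
    · intro b
      by_cases hb : b = b₀
      · exact ⟨Fin.last n, by simp [hb]⟩
      · obtain ⟨c, rfl⟩ := h.exists_liftBox_eq hb
        exact ⟨(U.symm c).castSucc, by simp⟩

@[simp]
theorem extend_last (h : IsRemoval L' L b₀) (U : Filling n L') :
    h.extend U (Fin.last n) = b₀ :=
  Fin.lastCases_last (motive := fun _ => Box L)

@[simp]
theorem extend_castSucc (h : IsRemoval L' L b₀) (U : Filling n L') (i : Fin n) :
    h.extend U i.castSucc = h.liftBox (U i) :=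
  Fin.lastCases_castSucc (motive := fun _ => Box L) i

theorem extend_injective (h : IsRemoval L' L b₀) :
    Function.Injective (h.extend : Filling n L' → Filling (n + 1) L) := fun U V hUV =>
  Equiv.ext fun i => h.liftBox_injective <| by
    rw [← extend_castSucc, hUV, extend_castSucc]

theorem exists_extend_eq (h : IsRemoval L' L b₀) {V : Filling (n + 1) L}
    (hV : V (Fin.last n) = b₀) : ∃ U : Filling n L', h.extend U = V := by
  have hne : ∀ i : Fin n, V i.castSucc ≠ b₀ := fun i hi =>
    i.castSucc_lt_last.ne (V.injective (hi.trans hV.symm))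
  choose f hf using fun i => h.exists_liftBox_eq (hne i)
  refine ⟨Equiv.ofBijective f ⟨fun i j hij => ?_, fun b => ?_⟩, Equiv.ext fun i => ?_⟩
  · exact Fin.castSucc_injective n (V.injective (by rw [← hf, ← hf, hij]))
  · obtain ⟨i, hi⟩ := V.surjective (h.liftBox b)
    induction i using Fin.lastCases with
    | last => exact absurd (hi.symm.trans hV) (h.liftBox_ne b)
    | cast i => exact ⟨i, h.liftBox_injective ((hf i).trans hi)⟩
  · induction i using Fin.lastCases with
    | last => rw [extend_last, hV]
    | cast i => exact (h.extend_castSucc _ i).trans (hf i)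

theorem extend_swapped (h : IsRemoval L' L b₀) (U : Filling n L') (x y : Fin n) :
    h.extend (swapped x y U) = swapped x.castSucc y.castSucc (h.extend U) := by
  refine Equiv.ext fun i => ?_
  induction i using Fin.lastCases with
  | last =>
    rw [Equiv.trans_apply, Equiv.swap_apply_of_ne_of_ne x.castSucc_lt_last.ne'
      y.castSucc_lt_last.ne', extend_last, extend_last]
  | cast i =>
    rw [Equiv.trans_apply, extend_castSucc, Equiv.trans_apply, ← extend_castSucc,
      (Fin.castSucc_injective n).map_swap]

theorem isStandard_extend_iff (h : IsRemoval L' L b₀) {U : Filling n L'} :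
    IsStandard (h.extend U) ↔ IsStandard U := by
  constructor
  · intro hU i j
    have := hU i.castSucc j.castSucc
    rw [extend_castSucc, extend_castSucc] at this
    exact this
  · intro hU i j hc
    induction i using Fin.lastCases with
    | last =>
      have hle := fun hr hcol => h.eq_of_le (b := h.extend U j) (by simpa using hc) hr hcol
      rw [extend_last]
      constructor
      · intro hr hcol
        exact absurd (congrArg Box.col (hle hr.le hcol.le)) hcol.ne'
      · intro hcol hr
        exact absurd (congrArg Box.row (hle hr.le hcol.le)) hr.ne'
    | cast i =>
      induction j using Fin.lastCases with
      | last => exact ⟨fun _ _ => i.castSucc_lt_last, fun _ _ => i.castSucc_lt_last⟩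
      | cast j =>
        rw [extend_castSucc, extend_castSucc] at hc ⊢
        exact hU i j hc

/-- The extension of standard bitableaux by the largest entry in the box `b₀`. -/
def extendStd (h : IsRemoval L' L b₀) (U : StdBitableau n L') : StdBitableau (n + 1) L :=
  ⟨h.extend U.1, h.isStandard_extend_iff.mpr U.2⟩

theorem extendStd_injective (h : IsRemoval L' L b₀) :
    Function.Injective (h.extendStd : StdBitableau n L' → StdBitableau (n + 1) L) :=
  fun _ _ hUV => Subtype.ext (h.extend_injective (congrArg Subtype.val hUV))

theorem mem_range_extendStd (h : IsRemoval L' L b₀) {V : StdBitableau (n + 1) L} :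
    V ∈ Set.range (h.extendStd : StdBitableau n L' → _) ↔ V.1 (Fin.last n) = b₀ := by
  constructor
  · rintro ⟨U, rfl⟩
    exact h.extend_last U.1
  · intro hV
    obtain ⟨U, hU⟩ := h.exists_extend_eq hV
    exact ⟨⟨U, h.isStandard_extend_iff.mp (hU ▸ V.2)⟩, Subtype.ext hU⟩

/-- The linear map that extends standard bitableaux by the largest entry in the box `b₀`. -/
def extendMap (h : IsRemoval L' L b₀) (n : ℕ) : M n L' →ₗ[K] M (n + 1) L :=
  Finsupp.lmapDomain K K h.extendStd

theorem extendMap_injective (h : IsRemoval L' L b₀) : Function.Injective (h.extendMap n) :=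
  Finsupp.mapDomain_injective h.extendStd_injective

theorem mem_range_extendMap (h : IsRemoval L' L b₀) {f : M (n + 1) L} :
    f ∈ LinearMap.range (h.extendMap n) ↔ ∀ V, f V ≠ 0 → V.1 (Fin.last n) = b₀ := by
  simp only [← h.mem_range_extendStd]
  constructor
  · rintro ⟨g, rfl⟩ V
    exact not_imp_comm.mp fun hV => Finsupp.mapDomain_of_notMem_range g V hV
  · intro hf
    exact ⟨_, Finsupp.mapDomain_comapDomain _ h.extendStd_injective f
      fun V hV => hf V (Finsupp.mem_support_iff.mp hV)⟩

theorem extendMap_vec (h : IsRemoval L' L b₀) (U : Filling n L') :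
    h.extendMap n (vec U) = vec (h.extend U) := by
  by_cases hU : IsStandard U
  · rw [vec_of_standard hU, vec_of_standard (h.isStandard_extend_iff.mpr hU)]
    exact Finsupp.mapDomain_single
  · rw [vec_of_not_standard hU, vec_of_not_standard (mt h.isStandard_extend_iff.mp hU), map_zero]

theorem extendMap_generatorOp (h : IsRemoval L' L b₀) (i : Fin n) (w : M n L') :
    h.extendMap n (generatorOp L' i w) = generatorOp L i.castSucc (h.extendMap n w) := by
  refine LinearMap.congr_fun (f := h.extendMap n ∘ₗ generatorOp L' i)
    (g := generatorOp L i.castSucc ∘ₗ h.extendMap n) (end_ext fun U _ => ?_) w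
  simp only [LinearMap.comp_apply, extendMap_vec]
  by_cases hi : i.val = 0
  · rw [generatorOp_zero_vec hi, generatorOp_zero_vec (o := i.castSucc) (by simpa using hi),
      map_smul, extendMap_vec, extend_castSucc]
    rfl
  · obtain ⟨x, hx⟩ : ∃ x : Fin n, x.val + 1 = i.val :=
      ⟨⟨i.val - 1, by omega⟩, by simp only; omega⟩
    rw [generatorOp_vec x hx, generatorOp_vec (i := i.castSucc) x.castSucc (by simpa using hx),
      map_add, map_smul, map_smul, extendMap_vec, extendMap_vec, extend_swapped, extend_castSucc,
      extend_castSucc]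
    rfl

theorem extendMap_apply (h : IsRemoval L' L b₀) {ρ : R (n + 1) →ₐ[K] Module.End K (M (n + 1) L)}
    (hρ : IsSeminormal ρ) {ρ' : R n →ₐ[K] Module.End K (M n L')} (hρ' : IsSeminormal ρ') (r : R n)
    (w : M n L') : h.extendMap n (ρ' r w) = ρ (incl n r) (h.extendMap n w) := by
  induction r using R.induction generalizing w with
  | algebraMap c => simp only [AlgHom.commutes, Module.algebraMap_end_apply, map_smul]
  | gen i =>
    have : incl n (T i) = T i.castSucc := by
      rw [incl, T, RingQuot.liftAlgHom_mkAlgHom_apply, FreeAlgebra.lift_ι_apply]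
    rw [this, isSeminormal_iff.mp hρ, isSeminormal_iff.mp hρ', extendMap_generatorOp]
  | add x y hx hy => simp only [map_add, LinearMap.add_apply, hx, hy]
  | mul x y hx hy => simp only [map_mul, Module.End.mul_apply, hx, hy]

theorem jmSpaceIso (hL : ∀ b : Box L, b.comp = 1 → b.col = 0) (h : IsRemoval L' L b₀)
    {ρ : R (n + 1) →ₐ[K] Module.End K (M (n + 1) L)} (hρ : IsSeminormal ρ)
    {ρ' : R n →ₐ[K] Module.End K (M n L')} (hρ' : IsSeminormal ρ') {α : K} (hα : weight b₀ = α) :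
    JMSpaceIso ρ α ρ' := by
  have key : ∀ V : StdBitableau (n + 1) L,
      V.1 (Fin.last n) = b₀ ↔ weight (V.1 (Fin.last n)) = α := by
    refine fun V => ⟨fun hV => hV ▸ hα, fun hV => ?_⟩
    obtain ⟨i, hi⟩ := V.1.surjective b₀
    -- The box of the largest entry and b₀ are comparable. Each is maximal in its component, the
    -- first by standardness and the second by `eq_of_le`, so they coincide.
    obtain ⟨hc, h1 | h1⟩ := comparable_of_weight_eq hL (hV.trans hα.symm)
    · rw [← hi] at hc h1
      have := V.2.le hc h1.1 h1.2
      rw [← hi, Fin.last_le_iff.mp this]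
    · exact h.eq_of_le hc.symm h1.1 h1.2
  have hrange : LinearMap.range (h.extendMap n) = jmSpace ρ α := by
    ext f
    simp only [h.mem_range_extendMap, hρ.mem_jmSpace, key]
  refine ⟨(LinearEquiv.ofInjective _ h.extendMap_injective).trans (LinearEquiv.ofEq _ _ hrange),
    fun r w => ?_⟩
  exact h.extendMap_apply hρ hρ' r w

end IsRemoval

/-! ### The shapes `(λ, 1^k)` -/

theorem mem_column {k : ℕ} {p : ℕ × ℕ} : p ∈ column k ↔ p.1 < k ∧ p.2 = 0 := by
  rw [← YoungDiagram.mem_cells, column, Finset.mem_product, Finset.mem_range,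
    Finset.mem_singleton]

theorem shape_col_eq_zero {lam : YoungDiagram} {k : ℕ} (b : Box (shape lam k))
    (hb : b.comp = 1) : b.col = 0 := by
  obtain ⟨⟨j, p⟩, h⟩ := b
  obtain rfl : j = 1 := hb
  exact (mem_column.mp h).2

theorem exists_isStandard_shape {lam : YoungDiagram} {k : ℕ} (h : lam.card + k = n) :
    ∃ U : Filling n (shape lam k), IsStandard U := by
  let hfin : ∀ j, Fintype {p // p ∈ shape lam k j} := fun j =>
    Fintype.subtype (shape lam k j).cells fun _ => YoungDiagram.mem_cells _
  have hcard : ∀ j, Fintype.card {p // p ∈ shape lam k j} = (shape lam k j).card := fun j =>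
    Fintype.card_of_subtype _ fun _ => YoungDiagram.mem_cells _
  let eqv : Box (shape lam k) ≃ Σ j, {p // p ∈ shape lam k j} :=
    Equiv.subtypeProdEquivSigmaSubtype fun j p => p ∈ shape lam k j
  let : Fintype (Box (shape lam k)) := Fintype.ofEquiv _ eqv.symm
  refine exists_isStandard ?_
  rw [Fintype.card_congr eqv, Fintype.card_sigma, Fin.sum_univ_two, hcard, hcard, ← h]
  simp [shape, column, YoungDiagram.card]

/-- Boxes of equal content are comparable, while a removable box has no other box beyond it. -/
theorem RemovesBox.subsingleton (lam : YoungDiagram) (i : ℤ) :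
    {mu : YoungDiagram | RemovesBox lam mu i}.Subsingleton := by
  have key : ∀ {mu : YoungDiagram} {p p' : ℕ × ℕ}, mu.cells = lam.cells.erase p → p' ∈ lam →
      p.1 ≤ p'.1 → p.2 ≤ p'.2 → p = p' := by
    intro mu p p' hmu hp' h1 h2
    by_contra hne
    have hmem : p' ∈ mu := by
      rw [← YoungDiagram.mem_cells, hmu]
      exact Finset.mem_erase.mpr ⟨Ne.symm hne, hp'⟩
    have := mu.up_left_mem h1 h2 hmem
    rw [← YoungDiagram.mem_cells, hmu] at this
    exact Finset.notMem_erase _ _ this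
  rintro mu ⟨r, c, hrc, hi, hmu⟩ mu' ⟨r', c', hrc', hi', hmu'⟩
  have : (r, c) = (r', c') := by
    rcases le_total r r' with h | h
    · exact key hmu hrc' h (by simp only; omega)
    · exact (key hmu' hrc h (by simp only; omega)).symm
  exact YoungDiagram.ext (by rw [hmu, hmu', this])

theorem isRemoval_of_cells_eq_erase {lam mu : YoungDiagram} {p : ℕ × ℕ} (k : ℕ) (hp : p ∈ lam)
    (hmu : mu.cells = lam.cells.erase p) :
    IsRemoval (shape mu k) (shape lam k) ⟨(0, p), hp⟩ := by
  rintro ⟨j, p'⟩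
  obtain rfl | rfl := fin_two_cases j
  · change p' ∈ mu ↔ p' ∈ lam ∧ _
    rw [← YoungDiagram.mem_cells, hmu, Finset.mem_erase, YoungDiagram.mem_cells, and_comm]
    simp
  · change p' ∈ column k ↔ p' ∈ column k ∧ _
    simp

theorem isRemoval_column (lam : YoungDiagram) (l : ℕ) :
    IsRemoval (shape lam l) (shape lam (l + 1))
      ⟨(1, l, 0), mem_column.mpr ⟨l.lt_succ_self, rfl⟩⟩ := by
  rintro ⟨j, r, c⟩
  obtain rfl | rfl := fin_two_cases j
  · change (r, c) ∈ lam ↔ (r, c) ∈ lam ∧ _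
    simp
  · change (r, c) ∈ column l ↔ (r, c) ∈ column (l + 1) ∧ _
    simp only [mem_column, ne_eq, Prod.mk.injEq, true_and]
    omega

theorem weight_ne_of_not_removesBox {lam : YoungDiagram} {k : ℕ} {i : ℤ}
    (h : ¬ ∃ mu : YoungDiagram, RemovesBox lam mu i) {V : Filling (n + 1) (shape lam k)}
    (hV : IsStandard V) : weight (V (Fin.last n)) ≠ q ^ i := by
  intro hw
  rw [weight] at hw
  split_ifs at hw with h0
  · obtain ⟨⟨⟨j, r, c⟩, hb⟩, hlast⟩ : ∃ b, V (Fin.last n) = b := ⟨_, rfl⟩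
    rw [hlast] at hw h0
    obtain rfl : j = 0 := h0
    -- The box of the largest entry is itself removable: a box beyond it would hold a larger entry.
    refine h ⟨⟨lam.cells.erase (r, c), fun p p' hp hmem => ?_⟩, r, c, hb, ?_, rfl⟩
    · rw [Finset.mem_coe, Finset.mem_erase] at hmem ⊢
      refine ⟨?_, lam.isLowerSet hp hmem.2⟩
      rintro rfl
      obtain ⟨x, hx⟩ := V.surjective ⟨(0, p), hmem.2⟩
      have hle : Fin.last n ≤ x := hV.le (by rw [hlast, hx]; rfl) (by rw [hlast, hx]; exact hp.1)
        (by rw [hlast, hx]; exact hp.2)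
      rw [Fin.last_le_iff.mp hle, hlast] at hx
      exact hmem.1 (congrArg (fun b => b.1.2) hx).symm
    · have := q_zpow_inj hw
      simpa [Box.content, Box.comp, Box.row, Box.col] using this
  · exact zpow_ne_zero _ q_ne_zero hw.symm

theorem weight_ne_zero_of_shape_zero {lam : YoungDiagram} (b : Box (shape lam 0)) :
    weight b ≠ 0 := by
  obtain ⟨⟨j, p⟩, h⟩ := b
  obtain rfl | rfl := fin_two_cases j
  · exact fun h => zpow_ne_zero _ q_ne_zero h
  · exact absurd (mem_column.mp h).1 (Nat.not_lt_zero _)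

end Mirabolic

end

/-! ### The theorem -/

open Mirabolic in
theorem mainTheorem5 :
    -- the seminormal formulas define a unique module structure, and it is irreducible
    (∀ (n : ℕ) (lam : YoungDiagram) (k : ℕ), lam.card + k = n →
      (∃! ρ : R n →ₐ[K] Module.End K (M n (shape lam k)), IsSeminormal ρ) ∧
      ∀ ρ : R n →ₐ[K] Module.End K (M n (shape lam k)), IsSeminormal ρ → IsIrreducible ρ) ∧
    ∀ (n : ℕ) (lam : YoungDiagram) (k : ℕ), lam.card + k = n + 1 →
      ∀ ρ : R (n + 1) →ₐ[K] Module.End K (M (n + 1) (shape lam k)), IsSeminormal ρ →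
        -- generalized eigenspaces of the last Jucys-Murphy element are eigenspaces
        (∀ α : K, jmSpace ρ α = (ρ (lastJM n)).eigenspace α) ∧
        -- (i)
        (∀ i : ℤ,
          {mu : YoungDiagram | RemovesBox lam mu i}.Subsingleton ∧
          (∀ mu : YoungDiagram, RemovesBox lam mu i →
            ∀ ρ' : R n →ₐ[K] Module.End K (M n (shape mu k)), IsSeminormal ρ' →
              JMSpaceIso ρ (q ^ i) ρ') ∧
          ((¬ ∃ mu : YoungDiagram, RemovesBox lam mu i) → jmSpace ρ (q ^ i) = ⊥)) ∧
        -- (ii)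
        (∀ l : ℕ, k = l + 1 →
          ∀ ρ' : R n →ₐ[K] Module.End K (M n (shape lam l)), IsSeminormal ρ' →
            JMSpaceIso ρ 0 ρ') ∧
        (k = 0 → jmSpace ρ 0 = ⊥) := by
  refine ⟨fun n lam k h => ⟨existsUnique_isSeminormal n shape_col_eq_zero, fun ρ hρ =>
    hρ.isIrreducible shape_col_eq_zero (exists_isStandard_shape h)⟩, fun n lam k _ ρ hρ =>
    ⟨hρ.jmSpace_eq_eigenspace, fun i => ⟨RemovesBox.subsingleton lam i, ?_, fun h =>
      hρ.jmSpace_eq_bot fun V hV => weight_ne_of_not_removesBox h hV⟩, ?_, ?_⟩⟩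
  · rintro mu ⟨r, c, hrc, hi, hmu⟩ ρ' hρ'
    refine (isRemoval_of_cells_eq_erase k hrc hmu).jmSpaceIso shape_col_eq_zero hρ hρ' ?_
    simp [weight, Box.content, Box.comp, Box.row, Box.col, hi]
  · rintro l rfl ρ' hρ'
    exact (isRemoval_column lam l).jmSpaceIso shape_col_eq_zero hρ hρ' rfl
  · rintro rfl
    exact hρ.jmSpace_eq_bot fun V _ => weight_ne_zero_of_shape_zero _
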